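/- Let $p\ge 1$ be an integer, $q=e^{2\pi i/p}$, $R=\mathbb{C}[z,z^{-1}]$, and let $\sigma$ be the automorphism of $R$ over $\mathbb{C}$ with $\sigma(z)=q^{-1}z$. Let $\omega=\{(z-q^k)\mid 0\le k\le p-1\}$, which is an orbit of $\sigma$ on the maximal ideals of $R$, and let $\mathsf{M}\subset R$ be the multiplicative monoid generated by the elements $z-q^k$, $0\le k\le p-1$. For $t\in\mathsf{M}$ let $A(t)$ be the generalized Weyl algebra obtained from $R$ by adjoining generators $X,Y$ with relations $Xr=\sigma(r)X$, $Yr=\sigma^{-1}(r)Y$ $(r\in R)$, $YX=t$, $XY=\sigma(t)$. Let $A(t)\text{-wmod}_\omega$ be the category of $A(t)$-modules $V$ such that $V=\bigoplus_{\mathfrak{m}}V_{\mathfrak m}$, the sum being over the maximal ideals of $R$ and $V_{\mathfrak m}=\{v\in V\mid \mathfrak{m}v=0\}$, such that $V_{\mathfrak m}=0$ for $\mathfrak m\notin\omega$, and such that every $V_{\mathfrak m}$ is finite dimensional over $R/\mathfrak m$. Let $K_0(A(t)\text{-wmod}_\omega)$ be its Grothendieck group, with relations $[V]=[U]+[W]$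 for all short exact sequences $0\to U\to V\to W\to 0$, and let $$\mathscr{A}(\omega,\mathsf{M})=\bigoplus_{t\in\mathsf{M}}\mathbb{C}\otimes_{\mathbb{Z}}K_0(A(t)\text{-wmod}_\omega),$$ a commutative $\mathsf{M}$-graded $\mathbb{C}$-algebra with product $[V][W]=[V\otimes_R W]$, where for an $A(t)$-module $V$ and an $A(t')$-module $W$ the generators $X$ and $Y$ of $A(tt')$ act on $V\otimes_R W$ by $X\otimes X$ and $Y\otimes Y$. For $\xi\in\mathbb{C}^\times$ let $u_\xi\in\mathscr{A}(\omega,\mathsf{M})$ be the class of the $A(1)$-module with $\mathbb{C}$-basis $e_k$ $(k\in\mathbb{Z}/p\mathbb{Z})$ and action $f e_k=f(q^k)e_k$ $(f\in R)$, $Xe_k=e_{k+1}$ and $Ye_{k+1}=e_k$ for $k\ne 0$, $Xe_0=\xi e_1$, $Ye_1=\xi^{-1}e_0$. Let $\mathscr{A}(p)$ be the quotient of $\mathscr{A}(\omega,\mathsf{M})$ by the ideal generated by $u_\xi-1$, $\xi\in\mathbb{C}^\times$. The map $\mathbb{N}^p\to\mathsf{M}$, $d=(d_1,\dots,d_p)\mapsto\prod_{k=0}^{p-1}(z-q^k)^{d_{k+1}}$,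 is bijective, and the algebra $\mathscr{A}(p)$ is $\mathbb{N}^p$-graded, the component $\mathscr{A}(p)_d$ being the image of the component of $\mathscr{A}(\omega,\mathsf{M})$ of the corresponding degree in $\mathsf{M}$. All the spaces $\mathscr{A}(p)_d$ are finite dimensional, and the following hold. (a) In $\mathbb{Q}[[T_1,\dots,T_p]]$, $$\sum_{d\in\mathbb{N}^p}(\dim\mathscr{A}(p)_d)\,T_1^{d_1}\cdots T_p^{d_p}=-1+\frac{2+T_1+T_2+\cdots+T_p}{(1-T_1)(1-T_2)\cdots(1-T_p)}.$$ (b) For $n\ge 0$ let $\mathscr{A}(p)_n=\sum_{d_1+\cdots+d_p=n}\mathscr{A}(p)_d$; it is finite dimensional. The Hilbert series of $\mathscr{A}(p)$ is $$H_{\mathscr{A}(p)}(T)=\sum_{n\ge0}(\dim\mathscr{A}(p)_n)\,T^n=-1+\frac{2+pT}{(1-T)^p}.$$ -/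

import Mathlib

open scoped TensorProduct LaurentPolynomial

/-! ### Generalized Weyl algebras -/

/-- Generators of a generalized Weyl algebra: the elements of `R`, and the two letters `X`, `Y`. -/
inductive GWAGen (R : Type) : Type
  | coe (r : R) : GWAGen R
  | X : GWAGen R
  | Y : GWAGen R

/-- The defining relations of the generalized Weyl algebra: `R` is a subring of coefficients
(first four relations), and `X r = σ(r) X`, `Y r = σ⁻¹(r) Y`, `Y X = t`, `X Y = σ(t)`. -/
inductive GWARel {R : Type} [CommRing R] (σ : R ≃+* R) (t : R) :
    FreeAlgebra ℤ (GWAGen R) → FreeAlgebra ℤ (GWAGen R) → Prop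
  | coe_one : GWARel σ t (FreeAlgebra.ι ℤ (.coe 1)) 1
  | coe_zero : GWARel σ t (FreeAlgebra.ι ℤ (.coe 0)) 0
  | coe_mul (r s : R) : GWARel σ t (FreeAlgebra.ι ℤ (.coe (r * s)))
      (FreeAlgebra.ι ℤ (.coe r) * FreeAlgebra.ι ℤ (.coe s))
  | coe_add (r s : R) : GWARel σ t (FreeAlgebra.ι ℤ (.coe (r + s)))
      (FreeAlgebra.ι ℤ (.coe r) + FreeAlgebra.ι ℤ (.coe s))
  | X_coe (r : R) : GWARel σ t (FreeAlgebra.ι ℤ .X * FreeAlgebra.ι ℤ (.coe r))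
      (FreeAlgebra.ι ℤ (.coe (σ r)) * FreeAlgebra.ι ℤ .X)
  | Y_coe (r : R) : GWARel σ t (FreeAlgebra.ι ℤ .Y * FreeAlgebra.ι ℤ (.coe r))
      (FreeAlgebra.ι ℤ (.coe (σ.symm r)) * FreeAlgebra.ι ℤ .Y)
  | Y_X : GWARel σ t (FreeAlgebra.ι ℤ .Y * FreeAlgebra.ι ℤ .X) (FreeAlgebra.ι ℤ (.coe t))
  | X_Y : GWARel σ t (FreeAlgebra.ι ℤ .X * FreeAlgebra.ι ℤ .Y) (FreeAlgebra.ι ℤ (.coe (σ t)))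

/-- The generalized Weyl algebra `A(R, σ, t)` of rank one. -/
def GWA {R : Type} [CommRing R] (σ : R ≃+* R) (t : R) : Type := RingQuot (GWARel σ t)

namespace GWA

variable {R : Type} [CommRing R] {σ : R ≃+* R} {t : R}

noncomputable instance : Ring (GWA σ t) := inferInstanceAs (Ring (RingQuot (GWARel σ t)))

/-- The quotient map from the free ring. -/
noncomputable def mk (σ : R ≃+* R) (t : R) : FreeAlgebra ℤ (GWAGen R) →+* GWA σ t :=
  RingQuot.mkRingHom (GWARel σ t)

theorem mk_surjective : Function.Surjective (mk σ t) := RingQuot.mkRingHom_surjective _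

theorem mk_rel {a b : FreeAlgebra ℤ (GWAGen R)} (h : GWARel σ t a b) : mk σ t a = mk σ t b :=
  RingQuot.mkRingHom_rel h

/-- The canonical ring homomorphism `R → A(R, σ, t)`. -/
noncomputable def coeff (σ : R ≃+* R) (t : R) : R →+* GWA σ t where
  toFun r := mk σ t (FreeAlgebra.ι ℤ (.coe r))
  map_one' := by rw [mk_rel .coe_one, map_one]
  map_zero' := by rw [mk_rel .coe_zero, map_zero]
  map_mul' r s := by rw [mk_rel (.coe_mul r s), map_mul]
  map_add' r s := by rw [mk_rel (.coe_add r s), map_add]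

/-- The generator `X` of `A(R, σ, t)`. -/
noncomputable def X (σ : R ≃+* R) (t : R) : GWA σ t := mk σ t (FreeAlgebra.ι ℤ .X)

/-- The generator `Y` of `A(R, σ, t)`. -/
noncomputable def Y (σ : R ≃+* R) (t : R) : GWA σ t := mk σ t (FreeAlgebra.ι ℤ .Y)

theorem X_mul_coeff (r : R) : X σ t * coeff σ t r = coeff σ t (σ r) * X σ t := by
  have := mk_rel (GWARel.X_coe (σ := σ) (t := t) r)
  rwa [map_mul, map_mul] at this

theorem Y_mul_coeff (r : R) : Y σ t * coeff σ t r = coeff σ t (σ.symm r) * Y σ t := by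
  have := mk_rel (GWARel.Y_coe (σ := σ) (t := t) r)
  rwa [map_mul, map_mul] at this

theorem Y_mul_X : Y σ t * X σ t = coeff σ t t := by
  have := mk_rel (GWARel.Y_X (σ := σ) (t := t))
  rwa [map_mul] at this

theorem X_mul_Y : X σ t * Y σ t = coeff σ t (σ t) := by
  have := mk_rel (GWARel.X_Y (σ := σ) (t := t))
  rwa [map_mul] at this

theorem induction {P : GWA σ t → Prop} (hc : ∀ r, P (coeff σ t r)) (hX : P (X σ t))
    (hY : P (Y σ t)) (hmul : ∀ a b, P a → P b → P (a * b)) (hadd : ∀ a b, P a → P b → P (a + b))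
    (a : GWA σ t) : P a := by
  obtain ⟨a, rfl⟩ := mk_surjective a
  induction a using FreeAlgebra.induction with
  | grade0 r =>
    have : mk σ t (algebraMap ℤ _ r) = coeff σ t (r : R) := by simp
    rw [this]
    exact hc _
  | grade1 x =>
    cases x with
    | coe r => exact hc r
    | X => exact hX
    | Y => exact hY
  | mul a b ha hb => rw [map_mul]; exact hmul _ _ ha hb
  | add a b ha hb => rw [map_add]; exact hadd _ _ ha hb

/-- The universal property of `A(R, σ, t)`. -/
noncomputable def lift {S : Type} [Ring S] (f : R →+* S) (x y : S)
    (hx : ∀ r, x * f r = f (σ r) * x) (hy : ∀ r, y * f r = f (σ.symm r) * y)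
    (hyx : y * x = f t) (hxy : x * y = f (σ t)) : GWA σ t →+* S :=
  RingQuot.lift ⟨((FreeAlgebra.lift ℤ (fun g : GWAGen R => match g with
    | .coe r => f r
    | .X => x
    | .Y => y) : FreeAlgebra ℤ (GWAGen R) →ₐ[ℤ] S) : FreeAlgebra ℤ (GWAGen R) →+* S), by
      intro a b h
      cases h <;> simp [hx, hy, hyx, hxy]⟩

section lift
variable {S : Type} [Ring S] (f : R →+* S) (x y : S)
    (hx : ∀ r, x * f r = f (σ r) * x) (hy : ∀ r, y * f r = f (σ.symm r) * y)
    (hyx : y * x = f t) (hxy : x * y = f (σ t))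

theorem lift_coeff (r : R) : lift f x y hx hy hyx hxy (coeff σ t r) = f r := by
  refine (RingQuot.lift_mkRingHom_apply _ _ _).trans ?_
  simp

theorem lift_X : lift f x y hx hy hyx hxy (X σ t) = x := by
  refine (RingQuot.lift_mkRingHom_apply _ _ _).trans ?_
  simp

theorem lift_Y : lift f x y hx hy hyx hxy (Y σ t) = y := by
  refine (RingQuot.lift_mkRingHom_apply _ _ _).trans ?_
  simp

end lift

end GWA

/-! ### Weight modules -/

/-- The weight space `V_𝔪 = {v | 𝔪 v = 0}` of an `R`-module. -/
abbrev weightSpace {R : Type} [CommRing R] (V : Type) [AddCommGroup V] [Module R V]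
    (m : MaximalSpectrum R) : Submodule R V :=
  Submodule.torsionBySet R V (m.asIdeal : Set R)

/-- `V` is the direct sum of its weight spaces, its support lies in `ω`, and each `V_𝔪` is finite
dimensional over `R/𝔪` (equivalently, as `R` acts on `V_𝔪` through `R/𝔪`, finitely generated
over `R`). -/
structure IsWeight {R : Type} [CommRing R] (ω : Set (MaximalSpectrum R)) (V : Type)
    [AddCommGroup V] [Module R V] : Prop where
  isInternal : letI := Classical.decEq (MaximalSpectrum R)
    DirectSum.IsInternal (fun m : MaximalSpectrum R => weightSpace V m)
  support : ∀ m : MaximalSpectrum R, weightSpace V m ≠ ⊥ → m ∈ ω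
  finite : ∀ m : MaximalSpectrum R, Module.Finite R (weightSpace V m)

section weight
variable {R : Type} [CommRing R] {ω : Set (MaximalSpectrum R)}
  {V : Type} [AddCommGroup V] [Module R V] {W : Type} [AddCommGroup W] [Module R W]

theorem iSupIndep_weightSpace (V : Type) [AddCommGroup V] [Module R V] :
    iSupIndep (fun m : MaximalSpectrum R => weightSpace V m) := by
  rw [iSupIndep_iff_supIndep]
  intro s
  apply Submodule.supIndep_torsionBySet_ideal
  intro m _ n _ hmn
  exact Ideal.isCoprime_iff_sup_eq.mp
    (Ideal.isCoprime_of_isMaximal (fun h => hmn (MaximalSpectrum.ext h)))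

theorem IsWeight.iSup_eq_top (h : IsWeight ω V) : ⨆ m ∈ ω, weightSpace V m = ⊤ := by
  classical
  have h1 := DirectSum.IsInternal.submodule_iSup_eq_top h.isInternal
  rw [eq_top_iff, ← h1]
  refine iSup_le fun m => ?_
  by_cases hm : weightSpace V m = ⊥
  · rw [hm]; exact bot_le
  · exact le_iSup₂_of_le m (h.support m hm) le_rfl

/-- A convenient criterion for being a weight module: it suffices to exhibit finitely generated
subspaces of the weight spaces in `ω` which together span. -/
theorem IsWeight.of_le (g : MaximalSpectrum R → Submodule R V)
    (hg : ∀ m, g m ≤ weightSpace V m) (hfin : ∀ m, (g m).FG) (hω : ∀ m, m ∉ ω → g m = ⊥)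
    (htop : ⨆ m, g m = ⊤) : IsWeight ω V := by
  classical
  have hind := iSupIndep_weightSpace (R := R) V
  have heq : ∀ m, weightSpace V m = g m := by
    intro m
    refine le_antisymm ?_ (hg m)
    have h1 : (⊤ : Submodule R V) ≤ g m ⊔ ⨆ (j) (_ : j ≠ m), weightSpace V j := by
      rw [← htop]
      refine iSup_le fun j => ?_
      by_cases hj : j = m
      · subst hj; exact le_sup_left
      · exact le_sup_of_le_right (le_iSup₂_of_le j hj (hg j))
    calc weightSpace V m = weightSpace V m ⊓ (g m ⊔ ⨆ (j) (_ : j ≠ m), weightSpace V j) := by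
          rw [top_le_iff.mp h1, inf_top_eq]
      _ = g m ⊔ ((⨆ (j) (_ : j ≠ m), weightSpace V j) ⊓ weightSpace V m) := by
          rw [inf_comm, sup_inf_assoc_of_le _ (hg m)]
      _ ≤ g m := by
          rw [inf_comm, (hind m).eq_bot, sup_bot_eq]
  refine ⟨?_, ?_, ?_⟩
  · refine (DirectSum.isInternal_submodule_iff_iSupIndep_and_iSup_eq_top _).mpr ⟨hind, ?_⟩
    simpa only [heq] using htop
  · intro m hm
    by_contra h
    exact hm (by rw [heq, hω m h])
  · intro m
    rw [heq]
    exact Module.Finite.iff_fg.mpr (hfin m)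

theorem IsWeight.tensor (hV : IsWeight ω V) (hW : IsWeight ω W) : IsWeight ω (V ⊗[R] W) := by
  classical
  refine IsWeight.of_le (fun m => Submodule.map₂ (TensorProduct.mk R V W)
    (weightSpace V m) (weightSpace W m)) ?_ ?_ ?_ ?_
  · intro m
    rw [Submodule.map₂_le]
    intro v hv w _
    rw [Submodule.mem_torsionBySet_iff] at hv ⊢
    intro a
    have := hv a
    rw [TensorProduct.mk_apply, TensorProduct.smul_tmul', this, TensorProduct.zero_tmul]
  · intro m
    exact Submodule.FG.map₂ _ (Module.Finite.iff_fg.mp (hV.finite m))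
      (Module.Finite.iff_fg.mp (hW.finite m))
  · intro m hm
    have : weightSpace V m = ⊥ := by
      by_contra h
      exact hm (hV.support m h)
    rw [this, Submodule.map₂_bot_left]
  · have hV1 := DirectSum.IsInternal.submodule_iSup_eq_top hV.isInternal
    have hW1 := DirectSum.IsInternal.submodule_iSup_eq_top hW.isInternal
    rw [eq_top_iff, ← TensorProduct.map₂_mk_top_top_eq_top, ← hV1, ← hW1,
      Submodule.map₂_iSup_left]
    refine iSup_le fun m => ?_
    rw [Submodule.map₂_iSup_right]
    refine iSup_le fun n => ?_
    by_cases hmn : m = n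
    · subst hmn
      exact le_iSup (fun m => Submodule.map₂ (TensorProduct.mk R V W)
        (weightSpace V m) (weightSpace W m)) m
    · rw [Submodule.map₂_le]
      intro v hv w hw
      rw [Submodule.mem_torsionBySet_iff] at hv hw
      have hco : IsCoprime m.asIdeal n.asIdeal :=
        Ideal.isCoprime_of_isMaximal (fun h => hmn (MaximalSpectrum.ext h))
      obtain ⟨a, ha, b, hb, hab⟩ := Ideal.isCoprime_iff_exists.mp hco
      have h1 : v ⊗ₜ[R] w = a • (v ⊗ₜ[R] w) + b • (v ⊗ₜ[R] w) := by
        rw [← add_smul, hab, one_smul]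
      have h2 : a • v = 0 := hv ⟨a, ha⟩
      have h3 : b • w = 0 := hw ⟨b, hb⟩
      rw [TensorProduct.mk_apply, h1, TensorProduct.smul_tmul', h2, TensorProduct.zero_tmul,
        ← TensorProduct.tmul_smul, h3, TensorProduct.tmul_zero, add_zero]
      exact Submodule.zero_mem _

theorem IsWeight.isSemisimple (hV : IsWeight ω V) : IsSemisimpleModule R V := by
  classical
  refine isSemisimpleModule_of_isSemisimpleModule_submodule'
    (p := fun m : MaximalSpectrum R => weightSpace V m) (fun m => ?_)
    (DirectSum.IsInternal.submodule_iSup_eq_top hV.isInternal)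
  have : m.asIdeal.IsMaximal := m.isMaximal
  let _ : Field (R ⧸ m.asIdeal) := Ideal.Quotient.field m.asIdeal
  exact (Module.IsTorsionBySet.isSemisimpleModule_iff
    (Submodule.torsionBySet_isTorsionBySet (R := R) (M := V) (m.asIdeal : Set R))).mp inferInstance

/-- Tensoring with an `R`-module preserves injectivity into a weight module. -/
theorem IsWeight.rTensor_injective (hW : IsWeight ω W) (f : V →ₗ[R] W)
    (hf : Function.Injective f) (U : Type) [AddCommGroup U] [Module R U] :
    Function.Injective (f.rTensor U) := by
  have := hW.isSemisimple
  obtain ⟨g, hg⟩ := IsSemisimpleModule.extension_property f hf LinearMap.id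
  apply Function.LeftInverse.injective (g := g.rTensor U)
  intro x
  rw [← LinearMap.comp_apply, ← LinearMap.rTensor_comp, hg, LinearMap.rTensor_id,
    LinearMap.id_apply]

end weight

/-- An object of `A(t)-wmod_ω`: a module over `A(t) = A(R, σ, t)` which, as an `R`-module via
`R → A(t)`, is a weight module with support in `ω` and finite dimensional weight spaces. The
`R`-module structure is the restriction of scalars (`coeff_smul`), hence no extra datum. -/
structure WeightModule {R : Type} [CommRing R] (σ : R ≃+* R) (ω : Set (MaximalSpectrum R))
    (t : R) : Type 1 where
  carrier : Type
  [addCommGroup : AddCommGroup carrier]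
  [moduleCoeff : Module R carrier]
  [moduleGWA : Module (GWA σ t) carrier]
  coeff_smul : ∀ (r : R) (v : carrier), GWA.coeff σ t r • v = r • v
  isWeight : IsWeight ω carrier

attribute [instance] WeightModule.addCommGroup WeightModule.moduleCoeff WeightModule.moduleGWA

namespace WeightModule

variable {R : Type} [CommRing R] {σ : R ≃+* R} {ω : Set (MaximalSpectrum R)} {t t' t'' : R}

/-- There is a short exact sequence `0 → U → V → W → 0` of `A(t)`-modules. -/
def IsExtension (U V W : WeightModule σ ω t) : Prop :=
  ∃ (f : U.carrier →ₗ[GWA σ t] V.carrier) (g : V.carrier →ₗ[GWA σ t] W.carrier),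
    Function.Injective f ∧ Function.Exact f g ∧ Function.Surjective g

/-- An `R`-linear map that commutes with `X` and `Y` is a homomorphism of `A(t)`-modules. -/
noncomputable def homOfCommutes (V W : WeightModule σ ω t) (f : V.carrier →ₗ[R] W.carrier)
    (hX : ∀ v, f (GWA.X σ t • v) = GWA.X σ t • f v)
    (hY : ∀ v, f (GWA.Y σ t • v) = GWA.Y σ t • f v) :
    V.carrier →ₗ[GWA σ t] W.carrier where
  toFun := f
  map_add' := f.map_add
  map_smul' a := by
    refine GWA.induction (P := fun a => ∀ v, f (a • v) = a • f v) ?_ hX hY ?_ ?_ a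
    · intro r v
      rw [V.coeff_smul, W.coeff_smul, f.map_smul]
    · intro a b ha hb v
      rw [mul_smul, ha, hb, mul_smul]
    · intro a b ha hb v
      rw [add_smul, f.map_add, ha, hb, add_smul]

/-- A homomorphism of `A(t)`-modules is `R`-linear. -/
noncomputable def homCoeff {V W : WeightModule σ ω t} (f : V.carrier →ₗ[GWA σ t] W.carrier) :
    V.carrier →ₗ[R] W.carrier where
  toFun := f
  map_add' := f.map_add
  map_smul' r v := by rw [RingHom.id_apply, ← V.coeff_smul, ← W.coeff_smul, f.map_smul]

/-- The ring homomorphism `R → End(V)` given by the `R`-action. -/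
def coeffEnd (V : Type) [AddCommGroup V] [Module R V] : R →+* AddMonoid.End V :=
  Module.toAddMonoidEnd R V

/-- The `A(t)`-module determined by an `R`-module `V` and additive endomorphisms `x`, `y` of `V`
that satisfy the defining relations of `A(t)`. -/
noncomputable def ofOperators (V : Type) [AddCommGroup V] [Module R V] (x y : V →+ V)
    (hx : ∀ r v, x (r • v) = σ r • x v) (hy : ∀ r v, y (r • v) = σ.symm r • y v)
    (hyx : ∀ v, y (x v) = t • v) (hxy : ∀ v, x (y v) = σ t • v) (hV : IsWeight ω V) :
    WeightModule σ ω t :=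
  letI : Module (GWA σ t) V := Module.compHom V
    (GWA.lift (S := AddMonoid.End V) (coeffEnd V) x y
      (fun r => AddMonoidHom.ext (hx r)) (fun r => AddMonoidHom.ext (hy r))
      (AddMonoidHom.ext hyx) (AddMonoidHom.ext hxy) : GWA σ t →+* AddMonoid.End V)
  { carrier := V
    coeff_smul := fun r v =>
      DFunLike.congr_fun (GWA.lift_coeff (S := AddMonoid.End V) (coeffEnd V) x y
        (fun r => AddMonoidHom.ext (hx r)) (fun r => AddMonoidHom.ext (hy r))
        (AddMonoidHom.ext hyx) (AddMonoidHom.ext hxy) r) v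
    isWeight := hV }

section ofOperators
variable (V : Type) [AddCommGroup V] [Module R V] (x y : V →+ V)
    (hx : ∀ r v, x (r • v) = σ r • x v) (hy : ∀ r v, y (r • v) = σ.symm r • y v)
    (hyx : ∀ v, y (x v) = t • v) (hxy : ∀ v, x (y v) = σ t • v) (hV : IsWeight ω V)

theorem X_smul_ofOperators (v : (ofOperators V x y hx hy hyx hxy hV).carrier) :
    GWA.X σ t • v = (show V from x v) :=
  DFunLike.congr_fun (GWA.lift_X (S := AddMonoid.End V) (coeffEnd V) x y
        (fun r => AddMonoidHom.ext (hx r)) (fun r => AddMonoidHom.ext (hy r))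
        (AddMonoidHom.ext hyx) (AddMonoidHom.ext hxy)) v

theorem Y_smul_ofOperators (v : (ofOperators V x y hx hy hyx hxy hV).carrier) :
    GWA.Y σ t • v = (show V from y v) :=
  DFunLike.congr_fun (GWA.lift_Y (S := AddMonoid.End V) (coeffEnd V) x y
        (fun r => AddMonoidHom.ext (hx r)) (fun r => AddMonoidHom.ext (hy r))
        (AddMonoidHom.ext hyx) (AddMonoidHom.ext hxy)) v

end ofOperators

/-- The action of `X` on an `A(t)`-module, as a `σ`-semilinear map. -/
noncomputable def opX (V : WeightModule σ ω t) : V.carrier →ₛₗ[(σ : R →+* R)] V.carrier where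
  toFun v := GWA.X σ t • v
  map_add' := smul_add _
  map_smul' r v := by
    rw [← V.coeff_smul, ← mul_smul, GWA.X_mul_coeff, mul_smul, V.coeff_smul]; rfl

/-- The action of `Y` on an `A(t)`-module, as a `σ⁻¹`-semilinear map. -/
noncomputable def opY (V : WeightModule σ ω t) :
    V.carrier →ₛₗ[(σ.symm : R →+* R)] V.carrier where
  toFun v := GWA.Y σ t • v
  map_add' := smul_add _
  map_smul' r v := by
    rw [← V.coeff_smul, ← mul_smul, GWA.Y_mul_coeff, mul_smul, V.coeff_smul]; rfl

theorem opY_opX (V : WeightModule σ ω t) (v : V.carrier) : V.opY (V.opX v) = t • v := by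
  change GWA.Y σ t • GWA.X σ t • v = t • v
  rw [← mul_smul, GWA.Y_mul_X, V.coeff_smul]

theorem opX_opY (V : WeightModule σ ω t) (v : V.carrier) : V.opX (V.opY v) = σ t • v := by
  change GWA.X σ t • GWA.Y σ t • v = σ t • v
  rw [← mul_smul, GWA.X_mul_Y, V.coeff_smul]

/-- The tensor product `V ⊗_R W` of an `A(t)`-module and an `A(t')`-module, regarded as an
`A(tt')`-module through `A(tt') → A(t) ⊗_R A(t')`, `r ↦ r ⊗ 1`, `X ↦ X ⊗ X`, `Y ↦ Y ⊗ Y`. -/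
noncomputable def tensor (V : WeightModule σ ω t) (W : WeightModule σ ω t') :
    WeightModule σ ω (t * t') :=
  ofOperators (V.carrier ⊗[R] W.carrier)
    (TensorProduct.map V.opX W.opX).toAddMonoidHom
    (TensorProduct.map V.opY W.opY).toAddMonoidHom
    (fun r v => (TensorProduct.map V.opX W.opX).map_smulₛₗ r v)
    (fun r v => (TensorProduct.map V.opY W.opY).map_smulₛₗ r v)
    (fun v => by
      change TensorProduct.map V.opY W.opY (TensorProduct.map V.opX W.opX v) = _
      induction v with
      | zero => simp
      | tmul v w =>
        rw [TensorProduct.map_tmul, TensorProduct.map_tmul, opY_opX, opY_opX,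
          TensorProduct.smul_tmul_smul]
      | add a b ha hb => rw [map_add, map_add, ha, hb, smul_add])
    (fun v => by
      change TensorProduct.map V.opX W.opX (TensorProduct.map V.opY W.opY v) = _
      induction v with
      | zero => simp
      | tmul v w =>
        rw [TensorProduct.map_tmul, TensorProduct.map_tmul, opX_opY, opX_opY,
          TensorProduct.smul_tmul_smul, map_mul]
      | add a b ha hb => rw [map_add, map_add, ha, hb, smul_add])
    (V.isWeight.tensor W.isWeight)

/-- The underlying `R`-module of the tensor product is `V ⊗_R W`. -/
noncomputable def tensorEquiv (V : WeightModule σ ω t) (W : WeightModule σ ω t') :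
    (V.carrier ⊗[R] W.carrier) ≃ₗ[R] (V.tensor W).carrier :=
  LinearEquiv.refl R (V.carrier ⊗[R] W.carrier)

/-- The pure tensor `v ⊗ w`. -/
noncomputable def tmul (V : WeightModule σ ω t) (W : WeightModule σ ω t')
    (v : V.carrier) (w : W.carrier) : (V.tensor W).carrier :=
  tensorEquiv V W (v ⊗ₜ[R] w)

theorem opX_tmul (V : WeightModule σ ω t) (W : WeightModule σ ω t')
    (v : V.carrier) (w : W.carrier) :
    (V.tensor W).opX (V.tmul W v w) = V.tmul W (V.opX v) (W.opX w) :=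
  (X_smul_ofOperators (V.carrier ⊗[R] W.carrier) _ _ _ _ _ _ _ (v ⊗ₜ[R] w)).trans
    (TensorProduct.map_tmul V.opX W.opX v w)

theorem opY_tmul (V : WeightModule σ ω t) (W : WeightModule σ ω t')
    (v : V.carrier) (w : W.carrier) :
    (V.tensor W).opY (V.tmul W v w) = V.tmul W (V.opY v) (W.opY w) :=
  (Y_smul_ofOperators (V.carrier ⊗[R] W.carrier) _ _ _ _ _ _ _ (v ⊗ₜ[R] w)).trans
    (TensorProduct.map_tmul V.opY W.opY v w)

theorem tensor_induction {V : WeightModule σ ω t} {W : WeightModule σ ω t'}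
    {P : (V.tensor W).carrier → Prop} (h0 : P 0) (ht : ∀ v w, P (V.tmul W v w))
    (ha : ∀ a b, P a → P b → P (a + b)) (u : (V.tensor W).carrier) : P u :=
  TensorProduct.induction_on (motive := P) u h0 ht ha

/-- Isomorphism of an `A(t)`-module with an `A(t')`-module, to be used when `t = t'`. -/
def IsIso (V : WeightModule σ ω t) (W : WeightModule σ ω t') : Prop :=
  ∃ e : V.carrier ≃ₗ[R] W.carrier, (∀ v, e (V.opX v) = W.opX (e v)) ∧
    ∀ v, e (V.opY v) = W.opY (e v)

theorem tensor_comm (V : WeightModule σ ω t) (W : WeightModule σ ω t') :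
    IsIso (V.tensor W) (W.tensor V) := by
  let e : (V.tensor W).carrier ≃ₗ[R] (W.tensor V).carrier :=
    (tensorEquiv V W).symm.trans ((TensorProduct.comm R _ _).trans (tensorEquiv W V))
  have he : ∀ v w, e (V.tmul W v w) = W.tmul V w v := fun v w => rfl
  refine ⟨e, fun u => ?_, fun u => ?_⟩
  · induction u using tensor_induction with
    | h0 => simp only [map_zero]
    | ht v w => rw [opX_tmul, he, he, opX_tmul]
    | ha a b ha hb => simp only [map_add, ha, hb]
  · induction u using tensor_induction with
    | h0 => simp only [map_zero]
    | ht v w => rw [opY_tmul, he, he, opY_tmul]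
    | ha a b ha hb => simp only [map_add, ha, hb]

theorem tmul_zero (V : WeightModule σ ω t) (W : WeightModule σ ω t') (v : V.carrier) :
    V.tmul W v 0 = 0 := TensorProduct.tmul_zero _ v

theorem zero_tmul (V : WeightModule σ ω t) (W : WeightModule σ ω t') (w : W.carrier) :
    V.tmul W 0 w = 0 := TensorProduct.zero_tmul _ w

theorem tmul_add (V : WeightModule σ ω t) (W : WeightModule σ ω t') (v : V.carrier)
    (w w' : W.carrier) : V.tmul W v (w + w') = V.tmul W v w + V.tmul W v w' :=
  TensorProduct.tmul_add v w w'

theorem add_tmul (V : WeightModule σ ω t) (W : WeightModule σ ω t') (v v' : V.carrier)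
    (w : W.carrier) : V.tmul W (v + v') w = V.tmul W v w + V.tmul W v' w :=
  TensorProduct.add_tmul v v' w

theorem tensor_assoc (U : WeightModule σ ω t) (V : WeightModule σ ω t')
    (W : WeightModule σ ω t'') : IsIso ((U.tensor V).tensor W) (U.tensor (V.tensor W)) := by
  let e : ((U.tensor V).tensor W).carrier ≃ₗ[R] (U.tensor (V.tensor W)).carrier :=
    (tensorEquiv (U.tensor V) W).symm.trans
      ((TensorProduct.congr (tensorEquiv U V).symm (LinearEquiv.refl R _)).trans
      ((TensorProduct.assoc R _ _ _).trans
      ((TensorProduct.congr (LinearEquiv.refl R _) (tensorEquiv V W)).trans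
        (tensorEquiv U (V.tensor W)))))
  have he : ∀ u v w, e ((U.tensor V).tmul W (U.tmul V u v) w) =
      U.tmul (V.tensor W) u (V.tmul W v w) := fun u v w => rfl
  refine ⟨e, fun u => ?_, fun u => ?_⟩
  · induction u using tensor_induction with
    | h0 => simp only [map_zero]
    | ht u w =>
      induction u using tensor_induction with
      | h0 => simp only [zero_tmul, map_zero]
      | ht u v => rw [opX_tmul, opX_tmul, he, he, opX_tmul, opX_tmul]
      | ha a b ha hb => simp only [add_tmul, map_add, ha, hb]
    | ha a b ha hb => simp only [map_add, ha, hb]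
  · induction u using tensor_induction with
    | h0 => simp only [map_zero]
    | ht u w =>
      induction u using tensor_induction with
      | h0 => simp only [zero_tmul, map_zero]
      | ht u v => rw [opY_tmul, opY_tmul, he, he, opY_tmul, opY_tmul]
      | ha a b ha hb => simp only [add_tmul, map_add, ha, hb]
    | ha a b ha hb => simp only [map_add, ha, hb]

theorem IsIso.isExtension_zero {V W Z : WeightModule σ ω t} (h : IsIso V W)
    (hZ : Subsingleton Z.carrier) : IsExtension V W Z := by
  obtain ⟨e, hX, hY⟩ := h
  refine ⟨homOfCommutes V W e hX hY, 0, e.injective, ?_, ?_⟩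
  · intro w
    simp only [LinearMap.zero_apply, true_iff]
    exact e.surjective w
  · intro z
    exact ⟨0, Subsingleton.elim _ _⟩

/-- The zero module. -/
noncomputable def zero (σ : R ≃+* R) (ω : Set (MaximalSpectrum R)) (t : R) :
    WeightModule σ ω t :=
  ofOperators PUnit 0 0 (fun _ _ => rfl) (fun _ _ => rfl) (fun _ => rfl) (fun _ => rfl)
    (IsWeight.of_le (fun _ => ⊥) (fun _ => bot_le) (fun _ => Submodule.fg_bot)
      (fun _ _ => rfl) (Subsingleton.elim _ _))

/-- Tensoring is exact on weight modules. -/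
theorem IsExtension.tensor_right {U V W : WeightModule σ ω t} (h : IsExtension U V W)
    (N : WeightModule σ ω t') : IsExtension (U.tensor N) (V.tensor N) (W.tensor N) := by
  obtain ⟨f, g, hf, hfg, hg⟩ := h
  let F : (U.tensor N).carrier →ₗ[R] (V.tensor N).carrier := (homCoeff f).rTensor N.carrier
  let G : (V.tensor N).carrier →ₗ[R] (W.tensor N).carrier := (homCoeff g).rTensor N.carrier
  have hF : ∀ u n, F (U.tmul N u n) = V.tmul N (f u) n := fun u n => rfl
  have hG : ∀ u n, G (V.tmul N u n) = W.tmul N (g u) n := fun u n => rfl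
  refine ⟨homOfCommutes _ _ F (fun u => ?_) (fun u => ?_),
    homOfCommutes _ _ G (fun u => ?_) (fun u => ?_), ?_, ?_, ?_⟩
  · change F ((U.tensor N).opX u) = (V.tensor N).opX (F u)
    induction u using tensor_induction with
    | h0 => simp only [map_zero]
    | ht u w =>
      rw [opX_tmul, hF, hF, opX_tmul]
      exact congrArg (fun z => V.tmul N z (N.opX w)) (f.map_smul _ u)
    | ha a b ha hb => simp only [map_add, ha, hb]
  · change F ((U.tensor N).opY u) = (V.tensor N).opY (F u)
    induction u using tensor_induction with
    | h0 => simp only [map_zero]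
    | ht u w =>
      rw [opY_tmul, hF, hF, opY_tmul]
      exact congrArg (fun z => V.tmul N z (N.opY w)) (f.map_smul _ u)
    | ha a b ha hb => simp only [map_add, ha, hb]
  · change G ((V.tensor N).opX u) = (W.tensor N).opX (G u)
    induction u using tensor_induction with
    | h0 => simp only [map_zero]
    | ht u w =>
      rw [opX_tmul, hG, hG, opX_tmul]
      exact congrArg (fun z => W.tmul N z (N.opX w)) (g.map_smul _ u)
    | ha a b ha hb => simp only [map_add, ha, hb]
  · change G ((V.tensor N).opY u) = (W.tensor N).opY (G u)
    induction u using tensor_induction with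
    | h0 => simp only [map_zero]
    | ht u w =>
      rw [opY_tmul, hG, hG, opY_tmul]
      exact congrArg (fun z => W.tmul N z (N.opY w)) (g.map_smul _ u)
    | ha a b ha hb => simp only [map_add, ha, hb]
  · exact V.isWeight.rTensor_injective (homCoeff f) hf N.carrier
  · exact rTensor_exact (f := homCoeff f) (g := homCoeff g) N.carrier hfg hg
  · exact LinearMap.rTensor_surjective N.carrier (g := homCoeff g) hg

end WeightModule

/-! ### Grothendieck groups -/

section K0
variable {R : Type} [CommRing R]

/-- The Grothendieck group `K₀(A(t)-wmod_ω)`: the abelian group generated by the objects, subject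
to `[V] = [U] + [W]` for every short exact sequence `0 → U → V → W → 0`. -/
def K0 (σ : R ≃+* R) (ω : Set (MaximalSpectrum R)) (t : R) : Type 1 :=
  FreeAbelianGroup (WeightModule σ ω t) ⧸ AddSubgroup.closure
    {a : FreeAbelianGroup (WeightModule σ ω t) | ∃ U V W : WeightModule σ ω t,
      WeightModule.IsExtension U V W ∧
      a = FreeAbelianGroup.of V - FreeAbelianGroup.of U - FreeAbelianGroup.of W}

noncomputable instance (σ : R ≃+* R) (ω : Set (MaximalSpectrum R)) (t : R) :
    AddCommGroup (K0 σ ω t) :=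
  inferInstanceAs (AddCommGroup (FreeAbelianGroup (WeightModule σ ω t) ⧸ AddSubgroup.closure _))

namespace K0

variable {σ : R ≃+* R} {ω : Set (MaximalSpectrum R)} {t : R}

/-- The class `[V]` in the Grothendieck group. -/
noncomputable def of (V : WeightModule σ ω t) : K0 σ ω t :=
  QuotientAddGroup.mk (FreeAbelianGroup.of V)

/-- An additive function on objects induces a homomorphism on the Grothendieck group. -/
noncomputable def lift {G : Type*} [AddCommGroup G] (φ : WeightModule σ ω t → G)
    (h : ∀ U V W, WeightModule.IsExtension U V W → φ V = φ U + φ W) : K0 σ ω t →+ G :=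
  QuotientAddGroup.lift _ (FreeAbelianGroup.lift φ) (by
    rw [AddSubgroup.closure_le]
    rintro a ⟨U, V, W, hE, rfl⟩
    simp [AddMonoidHom.mem_ker, h U V W hE])

theorem lift_of {G : Type*} [AddCommGroup G] (φ : WeightModule σ ω t → G)
    (h : ∀ U V W, WeightModule.IsExtension U V W → φ V = φ U + φ W) (V : WeightModule σ ω t) :
    lift φ h (of V) = φ V := by
  refine (QuotientAddGroup.lift_mk _ _ _).trans ?_
  simp

theorem hom_ext {G : Type*} [AddCommGroup G] {f g : K0 σ ω t →+ G}
    (h : ∀ V, f (of V) = g (of V)) : f = g := by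
  refine QuotientAddGroup.addMonoidHom_ext _ ?_
  ext V
  exact h V

theorem of_eq_add {U V W : WeightModule σ ω t} (h : WeightModule.IsExtension U V W) :
    of V = of U + of W := by
  have : of V - of U - of W = 0 :=
    (QuotientAddGroup.eq_zero_iff _).mpr (AddSubgroup.subset_closure ⟨U, V, W, h, rfl⟩)
  rw [sub_sub, sub_eq_zero] at this
  exact this

theorem of_eq_zero (Z : WeightModule σ ω t) (hZ : Subsingleton Z.carrier) : of Z = 0 := by
  have h : WeightModule.IsIso Z Z := ⟨LinearEquiv.refl R _, fun _ => rfl, fun _ => rfl⟩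
  have := of_eq_add (h.isExtension_zero hZ)
  simpa using this

theorem of_eq_of_isIso {V W : WeightModule σ ω t} (h : WeightModule.IsIso V W) :
    of V = of W := by
  have hZ : Subsingleton (WeightModule.zero σ ω t).carrier :=
    inferInstanceAs (Subsingleton PUnit)
  have := of_eq_add (h.isExtension_zero hZ)
  rw [of_eq_zero _ hZ, add_zero] at this
  exact this.symm

end K0

end K0

/-! ### The Grothendieck ring `𝒜(ω, M)` -/

section GrothendieckRing
variable {R : Type} [CommRing R]

/-- The `ℂ`-vector space `𝒜(ω, M) = ⨁_{t ∈ M} ℂ ⊗_ℤ K₀(A(t)-wmod_ω)`. -/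
def GrothendieckRing (σ : R ≃+* R) (ω : Set (MaximalSpectrum R)) (M : Submonoid R) : Type 1 :=
  DirectSum M (fun t => ℂ ⊗[ℤ] K0 σ ω (t : R))

namespace GrothendieckRing

variable {σ : R ≃+* R} {ω : Set (MaximalSpectrum R)} {M : Submonoid R}

noncomputable instance : AddCommGroup (GrothendieckRing σ ω M) :=
  inferInstanceAs (AddCommGroup (DirectSum M (fun t => ℂ ⊗[ℤ] K0 σ ω (t : R))))

noncomputable instance : Module ℂ (GrothendieckRing σ ω M) :=
  inferInstanceAs (Module ℂ (DirectSum M (fun t => ℂ ⊗[ℤ] K0 σ ω (t : R))))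

open scoped Classical in
/-- The inclusion of the component of degree `t`. -/
noncomputable def incl (σ : R ≃+* R) (ω : Set (MaximalSpectrum R)) {M : Submonoid R} (t : M) :
    (ℂ ⊗[ℤ] K0 σ ω (t : R)) →ₗ[ℂ] GrothendieckRing σ ω M :=
  DirectSum.lof ℂ M (fun t => ℂ ⊗[ℤ] K0 σ ω (t : R)) t

/-- The class `[V]` of an `A(t)`-module, placed in degree `t`. -/
noncomputable def cls (t : M) (V : WeightModule σ ω (t : R)) : GrothendieckRing σ ω M :=
  incl σ ω t (1 ⊗ₜ[ℤ] K0.of V)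

open scoped Classical in
/-- A linear map out of `𝒜(ω, M)` given by a family of additive functions on objects. -/
noncomputable def lift {E : Type*} [AddCommGroup E] [Module ℂ E]
    (φ : ∀ t : M, WeightModule σ ω (t : R) → E)
    (h : ∀ t U V W, WeightModule.IsExtension U V W → φ t V = φ t U + φ t W) :
    GrothendieckRing σ ω M →ₗ[ℂ] E :=
  DirectSum.toModule ℂ M E
    (fun t => LinearMap.liftBaseChange ℂ (K0.lift (φ t) (h t)).toIntLinearMap)

theorem lift_cls {E : Type*} [AddCommGroup E] [Module ℂ E]
    (φ : ∀ t : M, WeightModule σ ω (t : R) → E)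
    (h : ∀ t U V W, WeightModule.IsExtension U V W → φ t V = φ t U + φ t W)
    (t : M) (V : WeightModule σ ω (t : R)) : lift φ h (cls t V) = φ t V := by
  classical
  refine (DirectSum.toModule_lof ℂ t _).trans ?_
  rw [LinearMap.liftBaseChange_tmul, one_smul]
  exact K0.lift_of (φ t) (h t) V

theorem hom_ext {E : Type*} [AddCommGroup E] [Module ℂ E]
    {f g : GrothendieckRing σ ω M →ₗ[ℂ] E} (h : ∀ t V, f (cls t V) = g (cls t V)) : f = g := by
  classical
  refine DirectSum.linearMap_ext ℂ fun t => ?_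
  refine TensorProduct.AlgebraTensorModule.curry_injective ?_
  ext x
  have h2 : ((f.comp (incl σ ω t)).toAddMonoidHom.comp
      (TensorProduct.mk ℤ ℂ (K0 σ ω (t : R)) 1).toAddMonoidHom) =
      ((g.comp (incl σ ω t)).toAddMonoidHom.comp
      (TensorProduct.mk ℤ ℂ (K0 σ ω (t : R)) 1).toAddMonoidHom) :=
    K0.hom_ext (fun V => h t V)
  exact DFunLike.congr_fun h2 x

theorem cls_eq_add (t : M) {U V W : WeightModule σ ω (t : R)}
    (h : WeightModule.IsExtension U V W) : cls t V = cls t U + cls t W := by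
  rw [cls, K0.of_eq_add h, TensorProduct.tmul_add, map_add]
  rfl

theorem cls_eq_of_isIso {t t' : M} (ht : t = t') {V : WeightModule σ ω (t : R)}
    {W : WeightModule σ ω (t' : R)} (h : WeightModule.IsIso V W) : cls t V = cls t' W := by
  subst ht
  rw [cls, K0.of_eq_of_isIso h]
  rfl

/-- Multiplication by the class `[V]`: the linear map `[W] ↦ [V ⊗_R W]`. -/
noncomputable def mulCls (t : M) (V : WeightModule σ ω (t : R)) :
    GrothendieckRing σ ω M →ₗ[ℂ] GrothendieckRing σ ω M :=
  lift (fun t' W => cls (t * t') (V.tensor W)) (fun t' A B C h => by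
    have hc : ∀ W : WeightModule σ ω (t' : R),
        cls (t * t') (V.tensor W) = cls (t' * t) (W.tensor V) := fun W =>
      cls_eq_of_isIso (mul_comm t t') (WeightModule.tensor_comm V W)
    rw [hc, hc, hc]
    exact cls_eq_add (t' * t) (h.tensor_right V))

/-- The multiplication of `𝒜(ω, M)`: the bilinear map with `[V] [W] = [V ⊗_R W]`. -/
noncomputable def mulMap : GrothendieckRing σ ω M →ₗ[ℂ]
    GrothendieckRing σ ω M →ₗ[ℂ] GrothendieckRing σ ω M :=
  lift mulCls (fun t A B C h => by
    refine hom_ext fun t' W => ?_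
    rw [LinearMap.add_apply, mulCls, mulCls, mulCls, lift_cls, lift_cls, lift_cls]
    exact cls_eq_add (t * t') (h.tensor_right W))

noncomputable instance : Mul (GrothendieckRing σ ω M) := ⟨fun a b => mulMap a b⟩

theorem cls_mul_cls (t t' : M) (V : WeightModule σ ω (t : R)) (W : WeightModule σ ω (t' : R)) :
    cls t V * cls t' W = cls (t * t') (V.tensor W) := by
  change mulMap (cls t V) (cls t' W) = _
  rw [mulMap, lift_cls, mulCls, lift_cls]

protected theorem mul_comm' (a b : GrothendieckRing σ ω M) : a * b = b * a := by
  have : (mulMap : GrothendieckRing σ ω M →ₗ[ℂ] _) = mulMap.flip := by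
    refine hom_ext fun t V => hom_ext fun t' W => ?_
    change cls t V * cls t' W = cls t' W * cls t V
    rw [cls_mul_cls, cls_mul_cls]
    exact cls_eq_of_isIso (mul_comm t t') (WeightModule.tensor_comm V W)
  exact DFunLike.congr_fun (DFunLike.congr_fun this a) b

protected theorem mul_assoc' (a b c : GrothendieckRing σ ω M) : a * b * c = a * (b * c) := by
  let L : GrothendieckRing σ ω M →ₗ[ℂ] GrothendieckRing σ ω M →ₗ[ℂ]
      GrothendieckRing σ ω M →ₗ[ℂ] GrothendieckRing σ ω M :=
    LinearMap.mk₂ ℂ (fun a b => mulMap (mulMap a b))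
      (fun _ _ _ => by simp) (fun _ _ _ => by simp) (fun _ _ _ => by simp) (fun _ _ _ => by simp)
  let N : GrothendieckRing σ ω M →ₗ[ℂ] GrothendieckRing σ ω M →ₗ[ℂ]
      GrothendieckRing σ ω M →ₗ[ℂ] GrothendieckRing σ ω M :=
    LinearMap.mk₂ ℂ (fun a b => (mulMap a).comp (mulMap b))
      (fun _ _ _ => by rw [map_add, LinearMap.add_comp])
      (fun _ _ _ => by rw [map_smul, LinearMap.smul_comp])
      (fun _ _ _ => by rw [map_add, LinearMap.comp_add])
      (fun _ _ _ => by rw [map_smul, LinearMap.comp_smul])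
  have hLN : L = N := by
    refine hom_ext fun t U => hom_ext fun t' V => hom_ext fun t'' W => ?_
    change cls t U * cls t' V * cls t'' W = cls t U * (cls t' V * cls t'' W)
    rw [cls_mul_cls, cls_mul_cls, cls_mul_cls, cls_mul_cls]
    exact cls_eq_of_isIso (mul_assoc t t' t'') (WeightModule.tensor_assoc U V W)
  exact DFunLike.congr_fun (DFunLike.congr_fun (DFunLike.congr_fun hLN a) b) c

/-- `𝒜(ω, M)` is a commutative ring as soon as there is a unit object, that is an `A(1)`-module `I`
with `I ⊗_R V ≅ V` for all `V`. -/
@[reducible]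
noncomputable def commRingOfUnit (I : WeightModule σ ω ((1 : M) : R))
    (hI : ∀ (t : M) (V : WeightModule σ ω (t : R)), WeightModule.IsIso (I.tensor V) V) :
    CommRing (GrothendieckRing σ ω M) :=
  have one_mul' : ∀ a : GrothendieckRing σ ω M, cls 1 I * a = a := fun a => by
    have h : mulMap (cls 1 I) = (LinearMap.id : GrothendieckRing σ ω M →ₗ[ℂ] _) := by
      refine hom_ext fun t V => ?_
      change cls 1 I * cls t V = cls t V
      rw [cls_mul_cls]
      exact cls_eq_of_isIso (one_mul t) (hI t V)
    exact DFunLike.congr_fun h a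
  { (inferInstance : AddCommGroup (GrothendieckRing σ ω M)),
    (inferInstance : Mul (GrothendieckRing σ ω M)) with
    one := cls 1 I
    one_mul := one_mul'
    mul_one := fun a => (GrothendieckRing.mul_comm' a _).trans (one_mul' a)
    mul_comm := GrothendieckRing.mul_comm'
    mul_assoc := GrothendieckRing.mul_assoc'
    left_distrib := fun a b c => (mulMap a).map_add b c
    right_distrib := fun a b c => LinearMap.map_add₂ mulMap a b c
    zero_mul := fun a => LinearMap.map_zero₂ mulMap a
    mul_zero := fun a => (mulMap a).map_zero }

end GrothendieckRing

end GrothendieckRing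

/-! ### The case `R = ℂ[z, z⁻¹]`, `σ(z) = q⁻¹ z`, `q = exp(2πi/p)` -/

namespace RootOfUnityGWA

open LaurentPolynomial

/-- The root of unity `q = exp(2πi/p)`. -/
noncomputable def q (p : ℕ) : ℂˣ :=
  Units.mk0 (Complex.exp (2 * Real.pi * Complex.I / p)) (Complex.exp_ne_zero _)

/-- The variable `z` as a unit of `ℂ[z, z⁻¹]`. -/
noncomputable def z : (ℂ[T;T⁻¹])ˣ where
  val := T 1
  inv := T (-1)
  val_inv := by rw [← T_add]; simp
  inv_val := by rw [← T_add]; simp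

theorem ringHom_ext {S : Type} [CommRing S] {f g : ℂ[T;T⁻¹] →+* S}
    (hC : ∀ c : ℂ, f (C c) = g (C c)) (hT : f (T 1) = g (T 1)) : f = g := by
  refine IsLocalization.ringHom_ext (Submonoid.powers (Polynomial.X : Polynomial ℂ)) ?_
  refine Polynomial.ringHom_ext (fun c => ?_) ?_
  · simpa using hC c
  · simpa using hT

/-- The endomorphism `f(z) ↦ f(a z)` of `ℂ[z, z⁻¹]`. -/
noncomputable def scale (a : ℂˣ) : ℂ[T;T⁻¹] →+* ℂ[T;T⁻¹] :=
  LaurentPolynomial.eval₂ C (Units.map (C : ℂ →+* ℂ[T;T⁻¹]).toMonoidHom a * z)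

theorem scale_C (a : ℂˣ) (c : ℂ) : scale a (C c) = C c := eval₂_C _ _ c

theorem scale_T (a : ℂˣ) : scale a (T 1) = C (a : ℂ) * T 1 := by
  rw [scale, eval₂_T, zpow_one]; rfl

theorem scale_comp (a b : ℂˣ) (h : a * b = 1) : (scale a).comp (scale b) = RingHom.id _ := by
  refine ringHom_ext (fun c => ?_) ?_
  · simp [scale_C]
  · rw [RingHom.comp_apply, scale_T, map_mul, scale_C, scale_T, ← mul_assoc, ← map_mul,
      ← Units.val_mul, mul_comm b a, h]
    simp

/-- The automorphism `σ` of `ℂ[z, z⁻¹]` with `σ(z) = q⁻¹ z`. -/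
noncomputable def σ (p : ℕ) : ℂ[T;T⁻¹] ≃+* ℂ[T;T⁻¹] :=
  RingEquiv.ofRingHom (scale (q p)⁻¹) (scale (q p))
    (scale_comp _ _ (inv_mul_cancel _)) (scale_comp _ _ (mul_inv_cancel _))

/-- The elements `z - q^k`, `0 ≤ k ≤ p - 1`. -/
noncomputable def lin (p : ℕ) (k : Fin p) : ℂ[T;T⁻¹] := T 1 - C ((q p : ℂ) ^ (k : ℕ))

/-- The orbit `ω = {(z - q^k) | 0 ≤ k ≤ p - 1}` of the maximal ideal `(z - 1)` under `σ`. -/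
def ω (p : ℕ) : Set (MaximalSpectrum ℂ[T;T⁻¹]) :=
  {m | ∃ k : Fin p, m.asIdeal = Ideal.span {lin p k}}

/-- The multiplicative monoid `M` generated by the elements `z - q^k`. -/
noncomputable def M (p : ℕ) : Submonoid ℂ[T;T⁻¹] := Submonoid.closure (Set.range (lin p))

/-- The map `ℕ^p → M`, `d ↦ ∏ (z - q^k)^{d_k}`. -/
noncomputable def toM (p : ℕ) : Multiplicative (Fin p →₀ ℕ) →* M p where
  toFun d := ⟨∏ k, lin p k ^ (d.toAdd k), Submonoid.prod_mem _ fun k _ =>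
    Submonoid.pow_mem _ (Submonoid.subset_closure (Set.mem_range_self k)) _⟩
  map_one' := Subtype.ext (by simp)
  map_mul' d e := Subtype.ext (by simp [pow_add, Finset.prod_mul_distrib])

section modules
variable (p : ℕ)

/-- Evaluation at the points `q^k` of the orbit, `f ↦ (f(q^k))_k`. -/
noncomputable def evalOrbit : ℂ[T;T⁻¹] →+* (Fin p → ℂ) :=
  RingHom.pi fun k => LaurentPolynomial.eval₂ (RingHom.id ℂ) (q p ^ (k : ℕ))

theorem evalOrbit_C (c : ℂ) (k : Fin p) : evalOrbit p (C c) k = c := eval₂_C _ _ c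

theorem evalOrbit_T (k : Fin p) : evalOrbit p (T 1) k = (q p : ℂ) ^ (k : ℕ) := by
  refine (eval₂_T _ _ 1).trans ?_
  simp

/-- The space `⨁_k ℂ e_k`, `0 ≤ k ≤ p - 1`, on which `f ∈ ℂ[z, z⁻¹]` acts by `f e_k = f(q^k) e_k`;
that is, `⨁_k R/(z - q^k)`. -/
def OrbitSpace (p : ℕ) : Type := Fin p → ℂ

noncomputable instance : AddCommGroup (OrbitSpace p) := inferInstanceAs (AddCommGroup (Fin p → ℂ))

noncomputable instance : Module ℂ[T;T⁻¹] (OrbitSpace p) :=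
  Module.compHom (Fin p → ℂ) (evalOrbit p)

theorem orbit_smul (f : ℂ[T;T⁻¹]) (v : OrbitSpace p) (k : Fin p) :
    (f • v) k = evalOrbit p f k * v k := rfl

theorem sub_C_mem (k : Fin p) (f : ℂ[T;T⁻¹]) :
    f - C (evalOrbit p f k) ∈ Ideal.span {lin p k} := by
  have : Ideal.Quotient.mk (Ideal.span {lin p k}) =
      ((Ideal.Quotient.mk (Ideal.span {lin p k})).comp C).comp
        ((Pi.evalRingHom (fun _ : Fin p => ℂ) k).comp (evalOrbit p)) := by
    refine ringHom_ext (fun c => ?_) ?_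
    · change _ = Ideal.Quotient.mk (Ideal.span {lin p k}) (C (evalOrbit p (C c) k))
      rw [evalOrbit_C]
    · change _ = Ideal.Quotient.mk (Ideal.span {lin p k}) (C (evalOrbit p (T 1) k))
      rw [evalOrbit_T, Ideal.Quotient.eq]
      exact Ideal.subset_span rfl
  rw [← Ideal.Quotient.eq]
  exact DFunLike.congr_fun this f

theorem mem_span_lin (k : Fin p) (f : ℂ[T;T⁻¹]) :
    f ∈ Ideal.span {lin p k} ↔ evalOrbit p f k = 0 := by
  constructor
  · intro h
    obtain ⟨g, rfl⟩ := Ideal.mem_span_singleton'.mp h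
    rw [map_mul, Pi.mul_apply, lin, map_sub, Pi.sub_apply, evalOrbit_T, evalOrbit_C, sub_self,
      mul_zero]
  · intro h
    have := sub_C_mem p k f
    rwa [h, map_zero, sub_zero] at this

theorem smul_eq_zero_of_evalOrbit {V : Type} [AddCommGroup V] [Module ℂ[T;T⁻¹] V]
    (hV : IsWeight (ω p) V) {f : ℂ[T;T⁻¹]} (hf : evalOrbit p f = 0) (v : V) : f • v = 0 := by
  have hle : (⊤ : Submodule ℂ[T;T⁻¹] V) ≤ LinearMap.ker (LinearMap.lsmul ℂ[T;T⁻¹] V f) := by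
    rw [← hV.iSup_eq_top]
    refine iSup₂_le fun m hm v hv => ?_
    obtain ⟨k, hk⟩ := hm
    rw [Submodule.mem_torsionBySet_iff] at hv
    exact hv ⟨f, by
      change f ∈ m.asIdeal
      rw [hk, mem_span_lin, hf]
      rfl⟩
  exact hle (Submodule.mem_top (x := v))

variable [NeZero p]

theorem isPrimitiveRoot_q : IsPrimitiveRoot (q p : ℂ) p :=
  Complex.isPrimitiveRoot_exp p (NeZero.ne p)

theorem q_pow_add_one (j : Fin p) :
    (q p : ℂ) ^ ((j + 1 : Fin p) : ℕ) = (q p : ℂ) * (q p : ℂ) ^ (j : ℕ) := by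
  have h1 : (q p : ℂ) ^ p = 1 := (isPrimitiveRoot_q p).pow_eq_one
  rw [← pow_succ', Fin.val_add, ← pow_eq_pow_mod _ h1]
  rw [pow_add, pow_add]
  congr 1
  rw [Fin.val_one', ← pow_eq_pow_mod _ h1]

theorem evalOrbit_σ (f : ℂ[T;T⁻¹]) (j : Fin p) :
    evalOrbit p (σ p f) (j + 1) = evalOrbit p f j := by
  have : ((Pi.evalRingHom (fun _ : Fin p => ℂ) (j + 1)).comp (evalOrbit p)).comp
      (σ p : ℂ[T;T⁻¹] →+* ℂ[T;T⁻¹]) = (Pi.evalRingHom (fun _ : Fin p => ℂ) j).comp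
      (evalOrbit p) := by
    refine ringHom_ext (fun c => ?_) ?_
    · change evalOrbit p (scale _ (C c)) (j + 1) = evalOrbit p (C c) j
      rw [scale_C, evalOrbit_C, evalOrbit_C]
    · change evalOrbit p (scale _ (T 1)) (j + 1) = evalOrbit p (T 1) j
      rw [scale_T, map_mul, Pi.mul_apply, evalOrbit_C, evalOrbit_T, evalOrbit_T, q_pow_add_one,
        ← mul_assoc, ← Units.val_mul, inv_mul_cancel, Units.val_one, one_mul]
  exact DFunLike.congr_fun this f

theorem evalOrbit_surjective : Function.Surjective (evalOrbit p) := by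
  intro v
  let P : Polynomial ℂ := Lagrange.interpolate Finset.univ (fun k : Fin p => (q p : ℂ) ^ (k : ℕ)) v
  refine ⟨Polynomial.toLaurent P, ?_⟩
  funext k
  refine (eval₂_toLaurent _ _ P).trans ?_
  have hinj : Set.InjOn (fun k : Fin p => (q p : ℂ) ^ (k : ℕ)) (Finset.univ : Finset (Fin p)) := by
    intro a _ b _ hab
    exact Fin.ext ((isPrimitiveRoot_q p).pow_inj a.2 b.2 hab)
  have := Lagrange.eval_interpolate_at_node v hinj (Finset.mem_univ k)
  simp only [Polynomial.eval₂_id, Units.val_pow_eq_pow_val]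
  exact this

theorem isMaximal_span_lin (k : Fin p) : (Ideal.span {lin p k}).IsMaximal := by
  have h : Ideal.span {lin p k} =
      RingHom.ker ((Pi.evalRingHom (fun _ : Fin p => ℂ) k).comp (evalOrbit p)) := by
    ext f
    rw [mem_span_lin, RingHom.mem_ker]
    rfl
  rw [h]
  refine RingHom.ker_isMaximal_of_surjective _ ?_
  exact (Function.surjective_eval k).comp (evalOrbit_surjective p)

theorem isWeight_orbitSpace : IsWeight (ω p) (OrbitSpace p) := by
  classical
  let e : Fin p → OrbitSpace p := fun k => (Pi.single k 1 : Fin p → ℂ)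
  have hsmul : ∀ (f : ℂ[T;T⁻¹]) (k : Fin p), f • e k =
      (Pi.single k (evalOrbit p f k) : Fin p → ℂ) := by
    intro f k
    funext j
    rw [orbit_smul]
    by_cases h : j = k
    · subst h; simp [e]
    · simp [e, h]
  refine IsWeight.of_le (fun m => ⨆ (k : Fin p) (_ : m.asIdeal = Ideal.span {lin p k}),
    Submodule.span _ {e k}) ?_ ?_ ?_ ?_
  · intro m
    refine iSup₂_le fun k hk => ?_
    rw [Submodule.span_singleton_le_iff_mem, Submodule.mem_torsionBySet_iff]
    rintro ⟨a, ha⟩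
    have ha' : a ∈ m.asIdeal := ha
    rw [hk, mem_span_lin] at ha'
    rw [hsmul, ha', Pi.single_zero]
    rfl
  · intro m
    refine Submodule.fg_iSup _ fun k => ?_
    by_cases hk : m.asIdeal = Ideal.span {lin p k}
    · simp only [hk, iSup_pos]
      exact Submodule.fg_span_singleton _
    · simp only [hk, iSup_false]
      exact Submodule.fg_bot
  · intro m hm
    refine iSup₂_eq_bot.mpr fun k hk => ?_
    exact absurd ⟨k, hk⟩ hm
  · rw [eq_top_iff]
    intro v _
    have hv : v = ∑ k, (C (v k) : ℂ[T;T⁻¹]) • e k := by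
      funext j
      have : (∑ k, (C (v k) : ℂ[T;T⁻¹]) • e k) j = ∑ k, ((C (v k) : ℂ[T;T⁻¹]) • e k) j :=
        Finset.sum_apply j _ _
      rw [this, Finset.sum_eq_single j]
      · rw [hsmul, evalOrbit_C, Pi.single_eq_same]
      · intro k _ hk
        rw [hsmul, evalOrbit_C, Pi.single_eq_of_ne hk.symm]
      · intro h
        exact absurd (Finset.mem_univ j) h
    rw [hv]
    refine Submodule.sum_mem _ fun k _ => Submodule.smul_mem _ _ ?_
    refine Submodule.mem_iSup_of_mem ⟨Ideal.span {lin p k}, isMaximal_span_lin p k⟩ ?_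
    refine Submodule.mem_iSup_of_mem k (Submodule.mem_iSup_of_mem rfl ?_)
    exact Submodule.mem_span_singleton_self _

/-- The `A(1)`-module `V^1(ω, 1^p, x - ξ)`: it has basis `e_k`, `k ∈ ℤ/p`, with `e_k` of weight
`(z - q^k)`, `X e_k = e_{k+1}` and `Y e_{k+1} = e_k` for `k ≠ 0`, and `X e_0 = ξ e_1`,
`Y e_1 = ξ⁻¹ e_0`. -/
noncomputable def uModule (ξ : ℂˣ) : WeightModule (σ p) (ω p) (1 : ℂ[T;T⁻¹]) :=
  WeightModule.ofOperators (OrbitSpace p)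
    { toFun := fun v k => (if k = 1 then (ξ : ℂ) else 1) * v (k - 1)
      map_zero' := funext fun k => mul_zero _
      map_add' := fun v w => funext fun k => mul_add _ _ _ }
    { toFun := fun v k => (if k = 0 then ((ξ⁻¹ : ℂˣ) : ℂ) else 1) * v (k + 1)
      map_zero' := funext fun k => mul_zero _
      map_add' := fun v w => funext fun k => mul_add _ _ _ }
    (fun f v => funext fun k => by
      obtain ⟨j, rfl⟩ : ∃ j, k = j + 1 := ⟨k - 1, by simp⟩
      change _ * (evalOrbit p f (j + 1 - 1) * v (j + 1 - 1)) =
        evalOrbit p (σ p f) (j + 1) * (_ * v (j + 1 - 1))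
      rw [evalOrbit_σ, add_sub_cancel_right]
      ring)
    (fun f v => funext fun k => by
      change _ * (evalOrbit p f (k + 1) * v (k + 1)) =
        evalOrbit p ((σ p).symm f) k * (_ * v (k + 1))
      rw [← evalOrbit_σ p ((σ p).symm f) k, RingEquiv.apply_symm_apply]
      ring)
    (fun v => funext fun k => by
      change (if k = 0 then ((ξ⁻¹ : ℂˣ) : ℂ) else 1) *
        ((if k + 1 = 1 then (ξ : ℂ) else 1) * v (k + 1 - 1)) = ((1 : ℂ[T;T⁻¹]) • v) k
      rw [one_smul, add_sub_cancel_right]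
      by_cases h : k = 0
      · simp [h]
      · simp [h])
    (fun v => funext fun k => by
      change (if k = 1 then (ξ : ℂ) else 1) *
        ((if k - 1 = 0 then ((ξ⁻¹ : ℂˣ) : ℂ) else 1) * v (k - 1 + 1)) =
          (σ p 1 • v) k
      rw [map_one, one_smul, sub_add_cancel]
      by_cases h : k = 1
      · simp [h]
      · simp [h, sub_eq_zero])
    (isWeight_orbitSpace p)

theorem unit_isIso {t : ℂ[T;T⁻¹]} (V : WeightModule (σ p) (ω p) t) :
    WeightModule.IsIso ((uModule p 1).tensor V) V := by
  let ev : ℂ[T;T⁻¹] →ₗ[ℂ[T;T⁻¹]] OrbitSpace p :=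
    { toFun := evalOrbit p
      map_add' := map_add _
      map_smul' := fun f g => map_mul (evalOrbit p) f g }
  have hev : Function.Surjective ev := evalOrbit_surjective p
  let L : OrbitSpace p →ₗ[ℂ[T;T⁻¹]] V.carrier →ₗ[ℂ[T;T⁻¹]] V.carrier :=
    ((LinearMap.ker ev).liftQ (LinearMap.lsmul ℂ[T;T⁻¹] V.carrier) (by
      intro f hf
      ext v
      exact smul_eq_zero_of_evalOrbit p V.isWeight hf v)).comp
      (ev.quotKerEquivOfSurjective hev).symm.toLinearMap
  have hL : ∀ f v, L (ev f) v = f • v := by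
    intro f v
    have h1 : (ev.quotKerEquivOfSurjective hev).symm (ev f) = Submodule.Quotient.mk f := by
      rw [LinearEquiv.symm_apply_eq]
      rfl
    simp only [L, LinearMap.comp_apply, LinearEquiv.coe_coe, h1]
    rfl
  let one : (uModule p 1).carrier := (fun _ => 1 : Fin p → ℂ)
  have hone : ∀ f : ℂ[T;T⁻¹], f • one = ev f := by
    intro f
    funext k
    exact mul_one (evalOrbit p f k)
  have hXone : (uModule p 1).opX one = one := by
    refine (WeightModule.X_smul_ofOperators (OrbitSpace p) _ _ _ _ _ _ _ one).trans ?_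
    funext k
    change (if k = 1 then ((1 : ℂˣ) : ℂ) else 1) * 1 = 1
    simp
  have hYone : (uModule p 1).opY one = one := by
    refine (WeightModule.Y_smul_ofOperators (OrbitSpace p) _ _ _ _ _ _ _ one).trans ?_
    funext k
    change (if k = 0 then (((1 : ℂˣ)⁻¹ : ℂˣ) : ℂ) else 1) * 1 = 1
    simp
  let F : ((uModule p 1).tensor V).carrier →ₗ[ℂ[T;T⁻¹]] V.carrier :=
    (TensorProduct.lift L).comp (WeightModule.tensorEquiv (uModule p 1) V).symm.toLinearMap
  let G : V.carrier →ₗ[ℂ[T;T⁻¹]] ((uModule p 1).tensor V).carrier :=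
    (WeightModule.tensorEquiv (uModule p 1) V).toLinearMap.comp
      (TensorProduct.mk ℂ[T;T⁻¹] (uModule p 1).carrier V.carrier one)
  have hF : ∀ f v, F ((uModule p 1).tmul V (ev f) v) = f • v := fun f v =>
    (TensorProduct.lift.tmul (f' := L) (ev f) v).trans (hL f v)
  have hG : ∀ v, G v = (uModule p 1).tmul V one v := fun v => rfl
  have hone' : one = ev 1 := by rw [← hone, one_smul]
  have hFG : ∀ v, F (G v) = v := by
    intro v
    rw [hG, hone', hF, one_smul]
  have hpure : ∀ (f : ℂ[T;T⁻¹]) v, (uModule p 1).tmul V (ev f) v =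
      (uModule p 1).tmul V one (f • v) := by
    intro f v
    rw [← hone]
    exact congrArg (WeightModule.tensorEquiv (uModule p 1) V) (TensorProduct.smul_tmul f one v)
  have hGF : ∀ u, G (F u) = u := by
    intro u
    induction u using WeightModule.tensor_induction with
    | h0 => simp only [map_zero]
    | ht u v =>
      obtain ⟨f, rfl⟩ := hev u
      rw [hF, hG, hpure]
    | ha a b ha hb => simp only [map_add, ha, hb]
  let E : ((uModule p 1).tensor V).carrier ≃ₗ[ℂ[T;T⁻¹]] V.carrier :=
    { F with
      invFun := G
      left_inv := hGF
      right_inv := hFG }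
  refine ⟨E, fun u => ?_, fun u => ?_⟩
  · obtain ⟨v, rfl⟩ := E.symm.surjective u
    have h1 : ((uModule p 1).tensor V).opX (G v) = G (V.opX v) := by
      rw [hG, WeightModule.opX_tmul, hXone, hG]
    rw [LinearEquiv.apply_symm_apply]
    exact (congrArg F h1).trans (hFG _)
  · obtain ⟨v, rfl⟩ := E.symm.surjective u
    have h1 : ((uModule p 1).tensor V).opY (G v) = G (V.opY v) := by
      rw [hG, WeightModule.opY_tmul, hYone, hG]
    rw [LinearEquiv.apply_symm_apply]
    exact (congrArg F h1).trans (hFG _)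

end modules

/-! ### The rings `𝒜(ω, M)` and `𝒜(p)` -/

section rings
variable (p : ℕ) [NeZero p]

noncomputable instance : CommRing (GrothendieckRing (σ p) (ω p) (M p)) :=
  GrothendieckRing.commRingOfUnit (uModule p 1) (fun _ V => unit_isIso p V)

noncomputable instance : Algebra ℂ (GrothendieckRing (σ p) (ω p) (M p)) :=
  Algebra.ofModule (fun c a b => LinearMap.map_smul₂ GrothendieckRing.mulMap c a b)
    (fun c a b => (GrothendieckRing.mulMap a).map_smul c b)

/-- The element `u_ξ = [V^1(ω, 1^p, x - ξ)]` of `𝒜(ω, M)`. -/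
noncomputable def u (ξ : ℂˣ) : GrothendieckRing (σ p) (ω p) (M p) :=
  GrothendieckRing.cls 1 (uModule p ξ)

/-- The ideal of `𝒜(ω, M)` generated by all `u_ξ - 1`. -/
noncomputable def uIdeal : Ideal (GrothendieckRing (σ p) (ω p) (M p)) :=
  Ideal.span (Set.range fun ξ : ℂˣ => u p ξ - 1)

/-- The algebra `𝒜(p) = 𝒜(ω, M) / (u_ξ - 1 | ξ ∈ ℂˣ)`. -/
abbrev Ap : Type 1 := GrothendieckRing (σ p) (ω p) (M p) ⧸ uIdeal p

/-- The component `𝒜(p)_d`, `d ∈ ℕ^p`: the image of the component of `𝒜(ω, M)` of degree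
`∏ (z - q^k)^{d_k} ∈ M`. -/
noncomputable def piece (d : Fin p →₀ ℕ) : Submodule ℂ (Ap p) :=
  (LinearMap.range (GrothendieckRing.incl (σ p) (ω p) (toM p (Multiplicative.ofAdd d)))).map
    (Ideal.Quotient.mkₐ ℂ (uIdeal p)).toLinearMap

/-- The component of total degree `n`, i.e. the sum of the `𝒜(p)_d` with `d_1 + ⋯ + d_p = n`. -/
noncomputable def totalPiece (n : ℕ) : Submodule ℂ (Ap p) :=
  ⨆ (d : Fin p →₀ ℕ) (_ : ∑ i, d i = n), piece p d

/-- The series `∑_{d ∈ ℕ^p} (dim 𝒜(p)_d) T^d`. -/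
noncomputable def dimSeries : MvPowerSeries (Fin p) ℚ :=
  fun d => (Module.finrank ℂ (piece p d) : ℚ)

/-- The Hilbert series `∑_{n ≥ 0} (dim 𝒜(p)_n) T^n` with respect to the total degree. -/
noncomputable def hilbertSeries : PowerSeries ℚ :=
  PowerSeries.mk fun n => (Module.finrank ℂ (totalPiece p n) : ℚ)

end rings

end RootOfUnityGWA

/-!
The module `u_ξ ⊗ V` is `V` with the action of `X` twisted by `ξ` at one point of the orbit, so in
`𝒜(p)` twisting the action of `X` by units does not change the class of a module. After a twist by
a constant, every nonzero `A(t)`-module contains a vector fixed by `X` or by `Y`, or, if both are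
nilpotent, a simple module whose weights form a segment of the orbit ending at a zero `q^k` of `t`.
Hence `𝒜(p)_d` is spanned by `2 + |supp d|` classes of simple modules, of which the first two
coincide for `d = 0`. The ranks of high powers of `X`, of `Y` and of the projections to the weight
spaces are additive on extensions and invariant under twists, and show that these classes are
linearly independent. So `𝒜(p)_d` has dimension `2 + |supp d|` for `d ≠ 0` and `1` for `d = 0`,
which is (a), and (b) follows by setting all `T_i` equal to `T`.
-/

section StableRank

variable {K V : Type*} [Field K] [AddCommGroup V] [Module K V]

/-- The rank of the powers `f ^ n` for large `n` (in finite dimension): the dimension of the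
largest subspace which `f` maps onto itself. -/
noncomputable def stableRank (f : Module.End K V) : ℕ :=
  Module.finrank K ↥(⨅ n, LinearMap.range (f ^ n))

theorem stableRank_congr {f g : Module.End K V}
    (h : ∀ n, LinearMap.range (f ^ n) = LinearMap.range (g ^ n)) : stableRank f = stableRank g := by
  rw [stableRank, stableRank, iInf_congr h]

theorem stableRank_of_surjective {f : Module.End K V} (hf : Function.Surjective f) :
    stableRank f = Module.finrank K V := by
  have hrange n : LinearMap.range (f ^ n) = ⊤ := by
    rw [LinearMap.range_eq_top, Module.End.coe_pow]
    exact hf.iterate n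
  rw [stableRank, iInf_congr hrange, iInf_const, finrank_top]

theorem stableRank_of_isNilpotent {f : Module.End K V} (hf : IsNilpotent f) :
    stableRank f = 0 := by
  obtain ⟨n, hn⟩ := hf
  have hbot : ⨅ m, LinearMap.range (f ^ m) = ⊥ :=
    eq_bot_iff.mpr ((iInf_le _ n).trans (by rw [hn, LinearMap.range_zero]))
  rw [stableRank, hbot, finrank_bot]

theorem nontrivial_of_stableRank_ne_zero {f : Module.End K V} (hf : stableRank f ≠ 0) :
    Nontrivial V := by
  contrapose! hf
  exact stableRank_of_isNilpotent ⟨1, Subsingleton.elim _ _⟩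

theorem stableRank_mul_of_normalizes {f g : Module.End K V} (S : Submonoid (Module.End K V))
    (hS : ∀ h ∈ S, Function.Surjective h) (hg : g ∈ S)
    (hcomm : ∀ h ∈ S, ∃ h' ∈ S, h * f = f * h') : stableRank (f * g) = stableRank f := by
  have hpow n : ∃ h ∈ S, (f * g) ^ n = f ^ n * h := by
    induction n with
    | zero => exact ⟨1, S.one_mem, by simp only [pow_zero, mul_one]⟩
    | succ n ih =>
      obtain ⟨h, hh, ih⟩ := ih
      obtain ⟨h', hh', hhf⟩ := hcomm h hh
      refine ⟨h' * g, S.mul_mem hh' hg, ?_⟩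
      calc (f * g) ^ (n + 1) = f ^ n * (h * f) * g := by rw [pow_succ, ih]; simp only [mul_assoc]
        _ = f ^ (n + 1) * (h' * g) := by rw [hhf, pow_succ]; simp only [mul_assoc]
  refine stableRank_congr fun n => ?_
  obtain ⟨h, hh, hn⟩ := hpow n
  rw [hn, Module.End.mul_eq_comp, LinearMap.range_comp_of_range_eq_top _
    (LinearMap.range_eq_top.mpr (hS h hh))]

theorem stableRank_ne_zero_of_apply_eq_self [FiniteDimensional K V] {f : Module.End K V} {v : V}
    (hv : v ≠ 0) (hf : f v = v) : stableRank f ≠ 0 := by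
  have hmem : v ∈ ⨅ n, LinearMap.range (f ^ n) := by
    refine (Submodule.mem_iInf _).mpr fun n => ⟨v, ?_⟩
    rw [Module.End.coe_pow]
    exact Function.iterate_fixed hf n
  intro h
  rw [stableRank, Submodule.finrank_eq_zero] at h
  exact hv ((Submodule.mem_bot K).mp (h ▸ hmem))

section Exact

variable {U W : Type*} [AddCommGroup U] [Module K U] [AddCommGroup W] [Module K W]
  {i : U →ₗ[K] V} {g : V →ₗ[K] W}

theorem finrank_eq_add_finrank_map_of_exact [FiniteDimensional K V] (hi : Function.Injective i)
    (hig : Function.Exact i g) {A : Submodule K U} {B : Submodule K V}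
    (hAB : A.map i = B ⊓ LinearMap.range i) :
    Module.finrank K B = Module.finrank K A + Module.finrank K (B.map g) := by
  have hker : (LinearMap.ker (g.domRestrict B)).map B.subtype = A.map i := by
    rw [hAB, LinearMap.ker_domRestrict, Submodule.map_comap_subtype, hig.linearMap_ker_eq]
  have hrank := LinearMap.finrank_range_add_finrank_ker (g.domRestrict B)
  rw [LinearMap.range_domRestrict, ← Submodule.finrank_map_subtype_eq, hker,
    ← (Submodule.equivMapOfInjective i hi A).finrank_eq] at hrank
  omega

-- A vector `v` of the stable range of `b` is `(b ^ n) v'` with `v'` again in the stable range. If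
-- `g v = 0` then `(c ^ n) (g v') = 0`, so `g v' = 0` since `c ^ n` is injective on its stable
-- range.
theorem stableRank_eq_add_of_exact [FiniteDimensional K V] (hi : Function.Injective i)
    (hig : Function.Exact i g) (hg : Function.Surjective g) {a : Module.End K U}
    {b : Module.End K V} {c : Module.End K W}
    (hab : b ∘ₗ i = i ∘ₗ a) (hbc : c ∘ₗ g = g ∘ₗ b) :
    stableRank b = stableRank a + stableRank c := by
  have : FiniteDimensional K U := Module.Finite.of_injective i hi
  have : FiniteDimensional K W := Module.Finite.of_surjective g hg
  obtain ⟨n, ⟨ha, hb⟩, hc, hdisj⟩ := ((a.eventually_iInf_range_pow_eq.and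
    (Filter.eventually_forall_ge_atTop.mpr b.eventually_iInf_range_pow_eq)).and
      (c.eventually_iInf_range_pow_eq.and c.eventually_disjoint_ker_pow_range_pow)).exists
  have hin (u : U) : (b ^ n) (i u) = i ((a ^ n) u) :=
    LinearMap.congr_fun (Module.End.commute_pow_left_of_commute hab n) u
  have hgn (v : V) : (c ^ n) (g v) = g ((b ^ n) v) :=
    LinearMap.congr_fun (Module.End.commute_pow_left_of_commute hbc n) v
  have hmap_i : (LinearMap.range (a ^ n)).map i = LinearMap.range (b ^ n) ⊓ LinearMap.range i := by
    refine le_antisymm ?_ fun v ⟨hv, u, hu⟩ => ?_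
    · rintro _ ⟨_, ⟨u, rfl⟩, rfl⟩
      exact ⟨⟨i u, hin u⟩, ⟨_, rfl⟩⟩
    · obtain ⟨v', rfl⟩ : v ∈ LinearMap.range (b ^ (n + n)) := by
        rwa [← hb _ (Nat.le_add_left n n), hb n le_rfl]
      rw [pow_add, Module.End.mul_apply] at hu ⊢
      have hker : (c ^ n) (g ((b ^ n) v')) = 0 := by
        rw [hgn, ← hu, hig.apply_apply_eq_zero]
      have hg0 : g ((b ^ n) v') = 0 :=
        (Submodule.disjoint_def.mp hdisj) _ hker ⟨g v', hgn v'⟩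
      obtain ⟨u', hu'⟩ := (hig _).mp hg0
      exact ⟨_, ⟨u', rfl⟩, by rw [← hin, hu']⟩
  have hmap_g : (LinearMap.range (b ^ n)).map g = LinearMap.range (c ^ n) := by
    rw [← LinearMap.range_comp, ← Module.End.commute_pow_left_of_commute hbc,
      LinearMap.range_comp_of_range_eq_top _ (LinearMap.range_eq_top.mpr hg)]
  rw [stableRank, stableRank, stableRank, ha, hb n le_rfl, hc,
    finrank_eq_add_finrank_map_of_exact hi hig hmap_i, hmap_g]

end Exact

theorem exists_eigenvector_of_not_isNilpotent [IsAlgClosed K] [FiniteDimensional K V]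
    {f : Module.End K V} (hf : ¬ IsNilpotent f) :
    ∃ (c : K) (v : V), c ≠ 0 ∧ v ≠ 0 ∧ f v = c • v := by
  obtain ⟨n, hdisj, hn⟩ :=
    (f.eventually_disjoint_ker_pow_range_pow.and (Filter.eventually_ne_atTop 0)).exists
  have hmaps : ∀ v ∈ LinearMap.range (f ^ n), f v ∈ LinearMap.range (f ^ n) := by
    rintro _ ⟨v, rfl⟩
    exact ⟨f v, by rw [← Module.End.mul_apply, ← Module.End.mul_apply, ← pow_succ, ← pow_succ']⟩
  have hnontrivial : Nontrivial ↥(LinearMap.range (f ^ n)) := by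
    rw [Submodule.nontrivial_iff_ne_bot, Ne, LinearMap.range_eq_bot]
    exact fun h => hf ⟨n, h⟩
  obtain ⟨c, hc⟩ := Module.End.exists_eigenvalue (f.restrict hmaps)
  obtain ⟨⟨v, hv⟩, hev⟩ := hc.exists_hasEigenvector
  have hv0 : v ≠ 0 := fun h => hev.2 (Subtype.ext h)
  have hfv : f v = c • v := congrArg Subtype.val hev.apply_eq_smul
  refine ⟨c, v, ?_, hv0, hfv⟩
  rintro rfl
  refine hv0 (Submodule.disjoint_def.mp hdisj v ?_ hv)
  rw [LinearMap.mem_ker, ← Nat.sub_one_add_one hn, pow_succ, Module.End.mul_apply, hfv, zero_smul,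
    map_zero]

end StableRank

theorem finrank_iSup_of_iSupIndep {K V ι : Type*} [Field K] [AddCommGroup V] [Module K V]
    [Fintype ι] {W : ι → Submodule K V} [∀ i, Module.Finite K (W i)] (hW : iSupIndep W) :
    Module.finrank K (⨆ i, W i : Submodule K V) = ∑ i, Module.finrank K (W i) := by
  classical
  rw [Submodule.iSup_eq_range_dfinsupp_lsum,
    LinearMap.finrank_range_of_inj hW.dfinsupp_lsum_injective]
  exact Module.finrank_directSum _ _

section GeometricSeries

open MvPowerSeries

variable {τ K : Type*}

variable (τ K) in
/-- The series `∑_d T^d`, all of whose coefficients are `1`. -/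
def geomSeries [Semiring K] : MvPowerSeries τ K := fun _ => 1

theorem coeff_X_mul_geomSeries [Semiring K] (i : τ) (d : τ →₀ ℕ) :
    coeff d (X i * geomSeries τ K) = if d i ≠ 0 then 1 else 0 := by
  classical
  rw [X, coeff_monomial_mul, one_mul]
  exact if_congr (Finsupp.single_le_iff.trans Nat.one_le_iff_ne_zero) rfl rfl

theorem coeff_geomSeries_mul_prod_one_sub_X [CommRing K] (s : Finset τ) (d : τ →₀ ℕ) :
    coeff d (geomSeries τ K * ∏ i ∈ s, (1 - X i)) = if ∀ i ∈ s, d i = 0 then 1 else 0 := by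
  classical
  induction s using Finset.induction_on generalizing d with
  | empty =>
    rw [Finset.prod_empty, mul_one, if_pos fun i hi => absurd hi (Finset.notMem_empty i)]
    rfl
  | insert i s hi ih =>
    have hshift : (∀ j ∈ s, (d - Finsupp.single i 1 : τ →₀ ℕ) j = 0) ↔ ∀ j ∈ s, d j = 0 := by
      refine forall₂_congr fun j hj => ?_
      rw [Finsupp.tsub_apply, Finsupp.single_eq_of_ne fun h : j = i => hi (h ▸ hj), tsub_zero]
    rw [Finset.prod_insert hi, mul_left_comm, sub_mul, one_mul, map_sub, X, coeff_monomial_mul,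
      one_mul, ih, ih]
    simp only [hshift, Finsupp.single_le_iff, Nat.one_le_iff_ne_zero, Finset.forall_mem_insert]
    by_cases hdi : d i = 0 <;> by_cases hds : ∀ j ∈ s, d j = 0 <;> simp [hdi, hds]

variable [Fintype τ] [Field K]

theorem inv_prod_one_sub_X : (∏ i : τ, (1 - X i : MvPowerSeries τ K))⁻¹ = geomSeries τ K := by
  classical
  refine ((MvPowerSeries.eq_inv_iff_mul_eq_one ?_).mpr ?_).symm
  · simp
  · ext d
    rw [coeff_geomSeries_mul_prod_one_sub_X, coeff_one]
    simp only [Finset.mem_univ, true_imp_iff, DFunLike.ext_iff, Finsupp.coe_zero, Pi.zero_apply]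

theorem coeff_two_add_sum_X_mul_inv (d : τ →₀ ℕ) :
    coeff d ((2 + ∑ i, X i) * (∏ i, (1 - X i))⁻¹ : MvPowerSeries τ K) = 2 + d.support.card := by
  have hcard : ∑ i, (if d i ≠ 0 then 1 else 0 : K) = d.support.card := by
    rw [Finset.sum_boole]
    congr 2
    ext i
    simp
  rw [inv_prod_one_sub_X, add_mul, Finset.sum_mul, map_add, map_sum, two_mul, map_add]
  simp only [coeff_X_mul_geomSeries, hcard, ← one_add_one_eq_two]
  rfl

end GeometricSeries

section Specialization

variable {τ A : Type*} [CommRing A]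

theorem hasSubst_const_X [Finite τ] :
    MvPowerSeries.HasSubst fun _ : τ => (PowerSeries.X : PowerSeries A) :=
  MvPowerSeries.hasSubst_of_constantCoeff_zero fun _ => PowerSeries.constantCoeff_X

variable [Fintype τ]

variable (τ A) in
/-- The specialisation `T_i ↦ T` of multivariate power series. -/
noncomputable def diagonalize : MvPowerSeries τ A →ₐ[A] PowerSeries A :=
  MvPowerSeries.substAlgHom hasSubst_const_X

theorem diagonalize_X (i : τ) : diagonalize τ A (MvPowerSeries.X i) = PowerSeries.X :=
  MvPowerSeries.substAlgHom_X hasSubst_const_X i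

theorem coeff_diagonalize [DecidableEq τ] (n : ℕ) (f : MvPowerSeries τ A) :
    PowerSeries.coeff n (diagonalize τ A f) =
      ∑ d ∈ Finset.finsuppAntidiag Finset.univ n, MvPowerSeries.coeff d f := by
  have hcoeff (d : τ →₀ ℕ) :
      PowerSeries.coeff n (d.prod fun _ k => (PowerSeries.X : PowerSeries A) ^ k) =
        if d ∈ Finset.finsuppAntidiag Finset.univ n then 1 else 0 := by
    rw [Finsupp.prod_fintype _ _ fun _ => pow_zero _, Finset.prod_pow_eq_pow_sum,
      PowerSeries.coeff_X_pow]
    refine if_congr ?_ rfl rfl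
    rw [Finset.mem_finsuppAntidiag, and_iff_left (Finset.subset_univ _), eq_comm]
  calc PowerSeries.coeff n (diagonalize τ A f)
      = ∑ᶠ d, MvPowerSeries.coeff d f •
          PowerSeries.coeff n (d.prod fun _ k => (PowerSeries.X : PowerSeries A) ^ k) :=
        (congrArg _ (MvPowerSeries.substAlgHom_apply hasSubst_const_X f)).trans
          (MvPowerSeries.coeff_subst hasSubst_const_X f _)
    _ = ∑ᶠ d ∈ Finset.finsuppAntidiag Finset.univ n, MvPowerSeries.coeff d f := by
        simp only [hcoeff, smul_eq_mul, mul_ite, mul_one, mul_zero, finsum_eq_if]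
    _ = _ := finsum_mem_finset_eq_sum _ _

theorem diagonalize_inv {K : Type*} [Field K] {f : MvPowerSeries τ K}
    (hf : MvPowerSeries.constantCoeff f ≠ 0) :
    diagonalize τ K f⁻¹ = (diagonalize τ K f)⁻¹ := by
  have hmul : diagonalize τ K f⁻¹ * diagonalize τ K f = 1 := by
    rw [← map_mul, MvPowerSeries.inv_mul_cancel f hf, map_one]
  have hunit := (IsUnit.of_mul_eq_one_right _ hmul).map PowerSeries.constantCoeff
  exact (PowerSeries.eq_inv_iff_mul_eq_one hunit.ne_zero).mpr hmul

end Specialization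

theorem IsWeight.of_surjective {R : Type} [CommRing R] {ω : Set (MaximalSpectrum R)} {V W : Type}
    [AddCommGroup V] [Module R V] [AddCommGroup W] [Module R W] (hV : IsWeight ω V)
    (f : V →ₗ[R] W) (hf : Function.Surjective f) : IsWeight ω W := by
  classical
  refine IsWeight.of_le (fun m => (weightSpace V m).map f) (fun m => ?_) (fun m => ?_)
    (fun m hm => ?_) ?_
  · rintro _ ⟨v, hv, rfl⟩
    have hv := (Submodule.mem_torsionBySet_iff _ _).mp hv
    exact (Submodule.mem_torsionBySet_iff _ _).mpr fun a => by rw [← map_smul, hv, map_zero]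
  · exact (Module.Finite.iff_fg.mp (hV.finite m)).map f
  · rw [of_not_not fun h => hm (hV.support m h), Submodule.map_bot]
  · rw [← Submodule.map_iSup, hV.isInternal.submodule_iSup_eq_top, Submodule.map_top,
      LinearMap.range_eq_top.mpr hf]

namespace WeightModule

variable {R : Type} [CommRing R] {σ : R ≃+* R} {ω : Set (MaximalSpectrum R)} {t : R}

/-- The `A(t)`-submodule given by an `R`-submodule which is stable under `X` and `Y`. -/
def submoduleOfStable (V : WeightModule σ ω t) (N : Submodule R V.carrier)
    (hX : ∀ v ∈ N, GWA.X σ t • v ∈ N) (hY : ∀ v ∈ N, GWA.Y σ t • v ∈ N) :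
    Submodule (GWA σ t) V.carrier :=
  { N.toAddSubmonoid with
    smul_mem' := fun a v hv => by
      refine GWA.induction (P := fun a => ∀ v ∈ N, a • v ∈ N) (fun r v hv => ?_) hX hY
        (fun a b ha hb v hv => ?_) (fun a b ha hb v hv => ?_) a v hv
      · rw [V.coeff_smul]
        exact N.smul_mem r hv
      · rw [mul_smul]
        exact ha _ (hb v hv)
      · rw [add_smul]
        exact N.add_mem (ha v hv) (hb v hv) }

/-- The quotient of a weight module by an `A(t)`-submodule. -/
noncomputable def quotient (V : WeightModule σ ω t) (N : Submodule (GWA σ t) V.carrier) :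
    WeightModule σ ω t :=
  letI : Module R (V.carrier ⧸ N) := Module.compHom _ (GWA.coeff σ t)
  { carrier := V.carrier ⧸ N
    coeff_smul := fun _ _ => rfl
    isWeight := V.isWeight.of_surjective
      { N.mkQ with
        map_smul' := fun r v => by
          change N.mkQ (r • v) = GWA.coeff σ t r • N.mkQ v
          rw [← map_smul, V.coeff_smul] } N.mkQ_surjective }

/-- The projection of a weight module to its quotient. -/
noncomputable def quotientMk (V : WeightModule σ ω t) (N : Submodule (GWA σ t) V.carrier) :
    V.carrier →ₗ[GWA σ t] (V.quotient N).carrier := N.mkQ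

variable {V : WeightModule σ ω t} {N : Submodule (GWA σ t) V.carrier}

theorem quotientMk_surjective : Function.Surjective (V.quotientMk N) := N.mkQ_surjective

theorem quotientMk_eq_zero {v : V.carrier} : V.quotientMk N v = 0 ↔ v ∈ N :=
  Submodule.Quotient.mk_eq_zero N

theorem isExtension_quotient_range {U : WeightModule σ ω t}
    (f : U.carrier →ₗ[GWA σ t] V.carrier) (hf : Function.Injective f) :
    IsExtension U V (V.quotient (LinearMap.range f)) :=
  ⟨f, V.quotientMk _, hf, fun _ => quotientMk_eq_zero, quotientMk_surjective⟩

theorem exists_injective_of_ker_eq {W : WeightModule σ ω t}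
    (f : V.carrier →ₗ[GWA σ t] W.carrier) (hf : LinearMap.ker f = N) :
    ∃ g : (V.quotient N).carrier →ₗ[GWA σ t] W.carrier, Function.Injective g :=
  ⟨N.liftQ f hf.ge, LinearMap.ker_eq_bot.mp (Submodule.ker_liftQ_eq_bot _ _ _ hf.le)⟩

end WeightModule

theorem K0.linearMap_ext {R : Type} [CommRing R] {σ : R ≃+* R} {ω : Set (MaximalSpectrum R)} {t : R}
    {A E : Type*} [CommRing A] [AddCommGroup E] [Module A E] {f g : A ⊗[ℤ] K0 σ ω t →ₗ[A] E}
    (h : ∀ V, f (1 ⊗ₜ K0.of V) = g (1 ⊗ₜ K0.of V)) : f = g := by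
  refine TensorProduct.AlgebraTensorModule.curry_injective (LinearMap.ext_ring ?_)
  exact LinearMap.toAddMonoidHom_injective (K0.hom_ext h)

namespace RootOfUnityGWA

open LaurentPolynomial

variable {p : ℕ}

theorem coeff_C_commutes {t : ℂ[T;T⁻¹]} (c : ℂ) (a : GWA (σ p) t) :
    GWA.coeff (σ p) t (C c) * a = a * GWA.coeff (σ p) t (C c) := by
  induction a using GWA.induction with
  | hc r => rw [← map_mul, ← map_mul, mul_comm]
  | hX => rw [GWA.X_mul_coeff]; exact congrArg (GWA.coeff _ _ · * _) (scale_C _ c).symm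
  | hY => rw [GWA.Y_mul_coeff]; exact congrArg (GWA.coeff _ _ · * _) (scale_C _ c).symm
  | hmul a b ha hb => rw [← mul_assoc, ha, mul_assoc, hb, mul_assoc]
  | hadd a b ha hb => rw [mul_add, add_mul, ha, hb]

/-- The complex algebra structure of `A(t)`, given by `ℂ ⊆ ℂ[z, z⁻¹] → A(t)`. -/
noncomputable instance (t : ℂ[T;T⁻¹]) : Algebra ℂ (GWA (σ p) t) :=
  RingHom.toAlgebra' ((GWA.coeff (σ p) t).comp C) coeff_C_commutes

section Carrier

variable {t : ℂ[T;T⁻¹]} {V W : WeightModule (σ p) (ω p) t}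

/-- The complex vector space underlying a weight module. -/
noncomputable instance : Module ℂ V.carrier := Module.compHom V.carrier (C : ℂ →+* ℂ[T;T⁻¹])

theorem C_smul (c : ℂ) (v : V.carrier) : (C c : ℂ[T;T⁻¹]) • v = c • v := rfl

instance : IsScalarTower ℂ (GWA (σ p) t) V.carrier where
  smul_assoc c a v := by
    rw [Algebra.smul_def, mul_smul, ← C_smul, ← V.coeff_smul]
    rfl

variable (V) in
/-- The action of `A(t)` by complex linear endomorphisms. -/
noncomputable def act : GWA (σ p) t →ₐ[ℂ] Module.End ℂ V.carrier := Algebra.lsmul ℂ ℂ V.carrier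

variable (V) in
theorem ker_evalOrbit_le_ker_coeffEnd :
    RingHom.ker (evalOrbit p) ≤ RingHom.ker (WeightModule.coeffEnd V.carrier) := fun _ hf =>
  AddMonoidHom.ext (smul_eq_zero_of_evalOrbit p V.isWeight hf)

variable [NeZero p]

/-- A weight module is a module over `ℂ[z, z⁻¹] / ⋂_k (z - q^k)`, the ring of functions on the
orbit. -/
noncomputable instance : Module (Fin p → ℂ) V.carrier :=
  Module.compHom V.carrier <| (evalOrbit p).liftOfSurjective (evalOrbit_surjective p)
    ⟨WeightModule.coeffEnd V.carrier, ker_evalOrbit_le_ker_coeffEnd V⟩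

theorem evalOrbit_smul (f : ℂ[T;T⁻¹]) (v : V.carrier) : evalOrbit p f • v = f • v :=
  DFunLike.congr_fun (RingHom.liftOfRightInverse_comp_apply _ _
    (Function.rightInverse_surjInv (evalOrbit_surjective p))
    ⟨_, ker_evalOrbit_le_ker_coeffEnd V⟩ f) v

instance : IsScalarTower ℂ (Fin p → ℂ) V.carrier where
  smul_assoc c a v := by
    obtain ⟨f, rfl⟩ := evalOrbit_surjective p a
    have hc : c • evalOrbit p f = evalOrbit p (C c * f) := by
      funext k
      rw [map_mul, Pi.mul_apply, evalOrbit_C]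
      rfl
    rw [hc, evalOrbit_smul, evalOrbit_smul, mul_smul, C_smul]

instance : Module.Finite ℂ[T;T⁻¹] V.carrier := by
  have hω : Finite (ω p) := by
    refine Set.Finite.to_subtype ((Set.finite_range fun k : Fin p =>
      (⟨Ideal.span {lin p k}, isMaximal_span_lin p k⟩ : MaximalSpectrum ℂ[T;T⁻¹])).subset ?_)
    rintro m ⟨k, hk⟩
    exact ⟨k, MaximalSpectrum.ext hk.symm⟩
  rw [Module.finite_def, ← V.isWeight.iSup_eq_top, iSup_subtype']
  exact Submodule.fg_iSup _ fun m => Module.Finite.iff_fg.mp (V.isWeight.finite m)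

instance : FiniteDimensional ℂ V.carrier := by
  have hOrbit : Module.Finite (Fin p → ℂ) V.carrier :=
    Module.Finite.of_surjective (σ := evalOrbit p)
      ({ toFun := id
         map_add' := fun _ _ => rfl
         map_smul' := fun f v => (evalOrbit_smul f v).symm } : V.carrier →ₛₗ[evalOrbit p] V.carrier)
      Function.surjective_id
  exact Module.Finite.trans (Fin p → ℂ) V.carrier

variable (V) in
/-- The action of the functions on the orbit by complex linear endomorphisms. -/
noncomputable def orbitAct : (Fin p → ℂ) →ₐ[ℂ] Module.End ℂ V.carrier := Algebra.lsmul ℂ ℂ V.carrier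

theorem act_coeff (f : ℂ[T;T⁻¹]) :
    act V (GWA.coeff (σ p) t f) = orbitAct V (evalOrbit p f) :=
  LinearMap.ext fun v => (V.coeff_smul f v).trans (evalOrbit_smul f v).symm

theorem opX_orbit_smul (a : Fin p → ℂ) (v : V.carrier) :
    V.opX (a • v) = (fun k => a (k - 1)) • V.opX v := by
  obtain ⟨f, rfl⟩ := evalOrbit_surjective p a
  have hf : (fun k => evalOrbit p f (k - 1)) = evalOrbit p (σ p f) := by
    funext k
    rw [← evalOrbit_σ, sub_add_cancel]
  rw [evalOrbit_smul, map_smulₛₗ, hf, evalOrbit_smul]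
  rfl

theorem opY_orbit_smul (a : Fin p → ℂ) (v : V.carrier) :
    V.opY (a • v) = (fun k => a (k + 1)) • V.opY v := by
  obtain ⟨f, rfl⟩ := evalOrbit_surjective p a
  have hf : (fun k => evalOrbit p f (k + 1)) = evalOrbit p ((σ p).symm f) := by
    funext k
    rw [← evalOrbit_σ p ((σ p).symm f), RingEquiv.apply_symm_apply]
  rw [evalOrbit_smul, map_smulₛₗ, hf, evalOrbit_smul]
  rfl

theorem stableRank_act_of_isExtension {U : WeightModule (σ p) (ω p) t}
    (h : WeightModule.IsExtension U V W) (a : GWA (σ p) t) :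
    stableRank (act V a) = stableRank (act U a) + stableRank (act W a) := by
  obtain ⟨i, g, hi, hig, hg⟩ := h
  exact stableRank_eq_add_of_exact (i := i.restrictScalars ℂ) (g := g.restrictScalars ℂ) hi hig hg
    (LinearMap.ext fun u => (i.map_smul a u).symm) (LinearMap.ext fun v => (g.map_smul a v).symm)

theorem stableRank_orbitAct_of_isExtension {U : WeightModule (σ p) (ω p) t}
    (h : WeightModule.IsExtension U V W) (a : Fin p → ℂ) :
    stableRank (orbitAct V a) = stableRank (orbitAct U a) + stableRank (orbitAct W a) := by
  obtain ⟨f, rfl⟩ := evalOrbit_surjective p a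
  simp only [← act_coeff, stableRank_act_of_isExtension h]

theorem finrank_of_isExtension {U : WeightModule (σ p) (ω p) t}
    (h : WeightModule.IsExtension U V W) :
    Module.finrank ℂ V.carrier = Module.finrank ℂ U.carrier + Module.finrank ℂ W.carrier := by
  have hone (V : WeightModule (σ p) (ω p) t) :
      stableRank (act V 1) = Module.finrank ℂ V.carrier := by
    rw [map_one]
    exact stableRank_of_surjective Function.surjective_id
  simpa only [hone] using stableRank_act_of_isExtension h 1

end Carrier

variable [NeZero p]

section Twist

variable {t : ℂ[T;T⁻¹]} (V : WeightModule (σ p) (ω p) t)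

/-- The module `V` with `X` replaced by `X c` and `Y` by `c⁻¹ Y`, where `c` is a function without
zeros on the orbit. -/
noncomputable def twist (c : (Fin p → ℂ)ˣ) : WeightModule (σ p) (ω p) t :=
  WeightModule.ofOperators V.carrier
    (V.opX.toAddMonoidHom.comp (DistribSMul.toAddMonoidHom V.carrier c))
    ((DistribSMul.toAddMonoidHom V.carrier c⁻¹).comp V.opY.toAddMonoidHom)
    (fun r v => by
      change V.opX (c • r • v) = σ p r • V.opX (c • v)
      rw [← evalOrbit_smul, smul_comm, evalOrbit_smul, map_smulₛₗ]
      rfl)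
    (fun r v => by
      change c⁻¹ • V.opY (r • v) = (σ p).symm r • c⁻¹ • V.opY v
      rw [map_smulₛₗ, ← evalOrbit_smul, ← evalOrbit_smul, smul_comm]
      rfl)
    (fun v => by
      change c⁻¹ • V.opY (V.opX (c • v)) = t • v
      rw [WeightModule.opY_opX, ← evalOrbit_smul, smul_comm, inv_smul_smul, evalOrbit_smul])
    (fun v => by
      change V.opX (c • c⁻¹ • V.opY v) = σ p t • v
      rw [smul_inv_smul, WeightModule.opX_opY])
    V.isWeight

theorem opX_twist (c : (Fin p → ℂ)ˣ) (v : V.carrier) :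
    (twist V c).opX v = (V.opX (c • v) : V.carrier) :=
  WeightModule.X_smul_ofOperators V.carrier _ _ _ _ _ _ _ v

theorem opY_twist (c : (Fin p → ℂ)ˣ) (v : V.carrier) :
    (twist V c).opY v = (c⁻¹ • V.opY v : V.carrier) :=
  WeightModule.Y_smul_ofOperators V.carrier _ _ _ _ _ _ _ v

theorem stableRank_orbitAct_twist (c : (Fin p → ℂ)ˣ) (a : Fin p → ℂ) :
    stableRank (orbitAct (twist V c) a) = stableRank (orbitAct V a) := rfl

/-- The functions without zeros on the orbit, as endomorphisms of a weight module. -/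
noncomputable def orbitUnits : Submonoid (Module.End ℂ V.carrier) :=
  (IsUnit.submonoid (Fin p → ℂ)).map (orbitAct V)

theorem surjective_of_mem_orbitUnits {h : Module.End ℂ V.carrier} (hh : h ∈ orbitUnits V) :
    Function.Surjective h := by
  obtain ⟨_, ⟨c, rfl⟩, rfl⟩ := hh
  exact fun v => ⟨c⁻¹ • v, smul_inv_smul c v⟩

theorem stableRank_act_X_twist (c : (Fin p → ℂ)ˣ) :
    stableRank (act (twist V c) (GWA.X (σ p) t)) = stableRank (act V (GWA.X (σ p) t)) := by
  have hmul : (act (twist V c) (GWA.X (σ p) t) : Module.End ℂ V.carrier) =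
      act V (GWA.X (σ p) t) * orbitAct V c := LinearMap.ext (opX_twist V c)
  refine (congrArg (stableRank (V := V.carrier)) hmul).trans (stableRank_mul_of_normalizes
    (orbitUnits V) (fun _ => surjective_of_mem_orbitUnits V) ⟨_, c.isUnit, rfl⟩ ?_)
  rintro _ ⟨b, hb, rfl⟩
  refine ⟨_, ⟨fun k => b (k + 1), Pi.isUnit_iff.mpr fun k => Pi.isUnit_iff.mp hb _, rfl⟩,
    LinearMap.ext fun v => ((opX_orbit_smul _ v).trans ?_).symm⟩
  simp only [sub_add_cancel]
  rfl

theorem stableRank_act_Y_twist (c : (Fin p → ℂ)ˣ) :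
    stableRank (act (twist V c) (GWA.Y (σ p) t)) = stableRank (act V (GWA.Y (σ p) t)) := by
  have hcomm (b : Fin p → ℂ) : orbitAct V b * act V (GWA.Y (σ p) t) =
      act V (GWA.Y (σ p) t) * orbitAct V fun k => b (k - 1) :=
    LinearMap.ext fun v => by
      refine ((opY_orbit_smul _ v).trans ?_).symm
      simp only [add_sub_cancel_right]
      rfl
  have hshift {b : Fin p → ℂ} (hb : IsUnit b) : IsUnit fun k => b (k - 1) :=
    Pi.isUnit_iff.mpr fun k => Pi.isUnit_iff.mp hb _
  have hmul : (act (twist V c) (GWA.Y (σ p) t) : Module.End ℂ V.carrier) =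
      act V (GWA.Y (σ p) t) * orbitAct V fun k => (c⁻¹ : (Fin p → ℂ)ˣ).val (k - 1) :=
    (LinearMap.ext (opY_twist V c)).trans (hcomm _)
  refine (congrArg (stableRank (V := V.carrier)) hmul).trans (stableRank_mul_of_normalizes
    (orbitUnits V) (fun _ => surjective_of_mem_orbitUnits V) ⟨_, hshift c⁻¹.isUnit, rfl⟩ ?_)
  rintro _ ⟨b, hb, rfl⟩
  exact ⟨_, ⟨_, hshift hb, rfl⟩, hcomm b⟩

variable (p) in
/-- The function on the orbit with value `ξ` at `1` and `1` at the other points. -/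
noncomputable def pointUnit (ξ : ℂˣ) : (Fin p → ℂ)ˣ := MulEquiv.piUnits.symm (Pi.mulSingle 0 ξ)

theorem coe_pointUnit (ξ : ℂˣ) (k : Fin p) :
    (pointUnit p ξ : Fin p → ℂ) k = if k = 0 then (ξ : ℂ) else 1 := by
  change ((Pi.mulSingle 0 ξ : Fin p → ℂˣ) k : ℂ) = _
  rw [Pi.mulSingle_apply]
  split_ifs <;> rfl

theorem coe_pointUnit_inv (ξ : ℂˣ) (k : Fin p) :
    ((pointUnit p ξ)⁻¹ : (Fin p → ℂ)ˣ).val k = if k = 0 then ((ξ⁻¹ : ℂˣ) : ℂ) else 1 := by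
  rw [← coe_pointUnit, pointUnit, pointUnit, Pi.mulSingle_inv, map_inv]

-- Bijectivity does not involve the action of `X` and `Y` on the first factor, so that it follows
-- from the fact that `u_1` is a unit.
theorem bijective_one_tmul (ξ : ℂˣ) :
    Function.Bijective ((uModule p ξ).tmul V (fun _ => 1 : Fin p → ℂ)) := by
  let one : OrbitSpace p := (fun _ => 1 : Fin p → ℂ)
  let mk : V.carrier →ₗ[ℂ[T;T⁻¹]] OrbitSpace p ⊗[ℂ[T;T⁻¹]] V.carrier := TensorProduct.mk _ _ _ one
  have hsurj : Function.Surjective mk := fun u => by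
    induction u using TensorProduct.induction_on with
    | zero => exact ⟨0, map_zero mk⟩
    | tmul a v =>
      obtain ⟨f, hf⟩ := evalOrbit_surjective p a
      refine ⟨f • v, (TensorProduct.smul_tmul f one v).symm.trans (congrArg (· ⊗ₜ v) ?_)⟩
      exact funext fun k => (mul_one _).trans (congrFun hf k)
    | add _ _ ha hb =>
      obtain ⟨v, rfl⟩ := ha
      obtain ⟨w, rfl⟩ := hb
      exact ⟨v + w, map_add mk v w⟩
  obtain ⟨e, -⟩ := unit_isIso p V
  have hinj := OrzechProperty.injective_of_surjective_endomorphism (e.toLinearMap ∘ₗ mk)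
    (e.surjective.comp hsurj)
  exact ⟨Function.Injective.of_comp (f := e) hinj, hsurj⟩

theorem opX_uModule_one (ξ : ℂˣ) {f : ℂ[T;T⁻¹]} (hf : evalOrbit p f = pointUnit p ξ) :
    (uModule p ξ).opX (fun _ => 1 : Fin p → ℂ) = evalOrbit p (σ p f) := by
  refine (WeightModule.X_smul_ofOperators (OrbitSpace p) _ _ _ _ _ _ _ _).trans ?_
  funext k
  obtain ⟨k, rfl⟩ : ∃ j, k = j + 1 := ⟨k - 1, (sub_add_cancel k 1).symm⟩
  change (if k + 1 = 1 then (ξ : ℂ) else 1) * 1 = evalOrbit p (σ p f) (k + 1)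
  rw [mul_one, evalOrbit_σ, hf, coe_pointUnit]
  simp only [add_eq_right]

theorem opY_uModule_one (ξ : ℂˣ) {g : ℂ[T;T⁻¹]}
    (hg : evalOrbit p g = ((pointUnit p ξ)⁻¹ : (Fin p → ℂ)ˣ)) :
    (uModule p ξ).opY (fun _ => 1 : Fin p → ℂ) = evalOrbit p g := by
  refine (WeightModule.Y_smul_ofOperators (OrbitSpace p) _ _ _ _ _ _ _ _).trans ?_
  funext k
  change (if k = 0 then ((ξ⁻¹ : ℂˣ) : ℂ) else 1) * 1 = evalOrbit p g k
  rw [mul_one, hg, coe_pointUnit_inv]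

theorem uModule_tensor_isIso_twist (ξ : ℂˣ) :
    WeightModule.IsIso ((uModule p ξ).tensor V) (twist V (pointUnit p ξ)) := by
  let one : (uModule p ξ).carrier := (fun _ => 1 : Fin p → ℂ)
  let e : V.carrier ≃ₗ[ℂ[T;T⁻¹]] ((uModule p ξ).tensor V).carrier :=
    LinearEquiv.ofBijective (TensorProduct.mk _ _ _ one) (bijective_one_tmul V ξ)
  have he (v : V.carrier) : e v = (uModule p ξ).tmul V one v := rfl
  have hsmul (f : ℂ[T;T⁻¹]) (v : V.carrier) : (uModule p ξ).tmul V (f • one) v = e (f • v) :=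
    TensorProduct.smul_tmul f one v
  obtain ⟨f, hf⟩ := evalOrbit_surjective p (pointUnit p ξ)
  obtain ⟨g, hg⟩ := evalOrbit_surjective p ((pointUnit p ξ)⁻¹ : (Fin p → ℂ)ˣ)
  have hX_one : (uModule p ξ).opX one = σ p f • one :=
    (opX_uModule_one ξ hf).trans (funext fun k => (mul_one (evalOrbit p (σ p f) k)).symm)
  have hY_one : (uModule p ξ).opY one = g • one :=
    (opY_uModule_one ξ hg).trans (funext fun k => (mul_one (evalOrbit p g k)).symm)
  have hX (v : V.carrier) : ((uModule p ξ).tensor V).opX (e v) =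
      e (V.opX ((pointUnit p ξ : Fin p → ℂ) • v)) := by
    rw [he, WeightModule.opX_tmul, hX_one, hsmul, ← hf, evalOrbit_smul, map_smulₛₗ V.opX]
    rfl
  have hY (v : V.carrier) : ((uModule p ξ).tensor V).opY (e v) =
      e (((pointUnit p ξ)⁻¹ : (Fin p → ℂ)ˣ).val • V.opY v) := by
    rw [he, WeightModule.opY_tmul, hY_one, hsmul, ← hg, evalOrbit_smul]
  refine ⟨e.symm, fun u => ?_, fun u => ?_⟩ <;> obtain ⟨v, rfl⟩ := e.surjective u
  · refine (e.symm_apply_eq.mpr (hX v)).trans ((opX_twist V _ v).symm.trans ?_)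
    exact congrArg (twist V (pointUnit p ξ)).opX (e.symm_apply_apply v).symm
  · refine (e.symm_apply_eq.mpr (hY v)).trans ((opY_twist V _ v).symm.trans ?_)
    exact congrArg (twist V (pointUnit p ξ)).opY (e.symm_apply_apply v).symm

end Twist

theorem val_neg_one_add_one : (-1 : Fin p).val + 1 = p := by
  obtain _ | n := p
  · exact absurd rfl (NeZero.ne 0)
  · rw [Fin.coe_neg_one]

theorem val_sub_one_add_one {k : Fin p} (hk : k ≠ 0) : (k - 1).val + 1 = k.val := by
  rw [Fin.val_sub_one_of_ne_zero hk, Nat.sub_add_cancel]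
  exact Nat.pos_of_ne_zero (Fin.val_ne_zero_iff.mpr hk)

theorem cyclic_induction_up {P : Fin p → Prop} (k : Fin p) (hk : P k)
    (hstep : ∀ l, P l → P (l + 1)) (l : Fin p) : P l := by
  obtain _ | n := p
  · exact l.elim0
  suffices h : ∀ j, P (k + j) by simpa only [add_sub_cancel] using h (l - k)
  refine Fin.induction (by rwa [add_zero]) fun i hi => ?_
  rw [← Fin.coeSucc_eq_succ, ← add_assoc]
  exact hstep _ hi

theorem cyclic_induction_down {P : Fin p → Prop} (k : Fin p) (hk : P k)
    (hstep : ∀ l, P (l + 1) → P l) (l : Fin p) : P l := by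
  rw [← neg_neg l]
  refine cyclic_induction_up (P := fun l => P (-l)) (-k) (by rwa [neg_neg]) (fun j hj => ?_) _
  exact hstep _ (by rwa [neg_add, neg_add_cancel_right])

variable (p) in
/-- The quotient map `𝒜(ω, M) → 𝒜(p)`. -/
noncomputable abbrev toAp : GrothendieckRing (σ p) (ω p) (M p) →ₐ[ℂ] Ap p :=
  Ideal.Quotient.mkₐ ℂ (uIdeal p)

/-- The class `[V]` in `𝒜(p)` of an `A(t)`-module. -/
noncomputable def classAp (t : M p) (V : WeightModule (σ p) (ω p) (t : ℂ[T;T⁻¹])) : Ap p :=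
  toAp p (GrothendieckRing.cls t V)

section ClassAp

variable {t : M p} {V W : WeightModule (σ p) (ω p) (t : ℂ[T;T⁻¹])}

theorem classAp_eq_add {U : WeightModule (σ p) (ω p) (t : ℂ[T;T⁻¹])}
    (h : WeightModule.IsExtension U V W) : classAp t V = classAp t U + classAp t W := by
  rw [classAp, GrothendieckRing.cls_eq_add t h, map_add]
  rfl

theorem classAp_eq_zero [Subsingleton V.carrier] : classAp t V = 0 := by
  rw [classAp, GrothendieckRing.cls, K0.of_eq_zero V inferInstance, TensorProduct.tmul_zero,
    map_zero, map_zero]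

theorem u_mul_cls (ξ : ℂˣ) (V : WeightModule (σ p) (ω p) (t : ℂ[T;T⁻¹])) :
    u p ξ * GrothendieckRing.cls t V = GrothendieckRing.cls t (twist V (pointUnit p ξ)) :=
  (GrothendieckRing.cls_mul_cls 1 t (uModule p ξ) V).trans
    (GrothendieckRing.cls_eq_of_isIso (one_mul t) (uModule_tensor_isIso_twist V ξ))

theorem toAp_u (ξ : ℂˣ) : toAp p (u p ξ) = 1 := by
  rw [← sub_eq_zero, ← map_one (toAp p), ← map_sub]
  exact Ideal.Quotient.eq_zero_iff_mem.mpr (Ideal.subset_span ⟨ξ, rfl⟩)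

theorem classAp_twist_pointUnit (ξ : ℂˣ) :
    classAp t (twist V (pointUnit p ξ)) = classAp t V := by
  rw [classAp, ← u_mul_cls, map_mul, toAp_u, one_mul, classAp]

theorem twist_isIso {t : ℂ[T;T⁻¹]} (V : WeightModule (σ p) (ω p) t) {c c' g : (Fin p → ℂ)ˣ}
    (hg : (fun k => (g : Fin p → ℂ) (k + 1)) * (c : Fin p → ℂ) = c' * g) :
    WeightModule.IsIso (twist V c) (twist V c') := by
  set g' : Fin p → ℂ := fun k => (g : Fin p → ℂ) (k + 1) with hg'
  let e : (twist V c).carrier ≃ₗ[ℂ[T;T⁻¹]] (twist V c').carrier :=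
    { DistribMulAction.toAddEquiv V.carrier g with
      map_smul' := fun r v => by
        change g • (r • v : V.carrier) = r • (g • v : V.carrier)
        rw [← evalOrbit_smul, smul_comm, evalOrbit_smul] }
  have hX (v : V.carrier) : g • V.opX (c • v) = V.opX (c' • g • v) := by
    calc g • V.opX (c • v) = V.opX (g' • (c : Fin p → ℂ) • v) := by
          rw [opX_orbit_smul]
          simp only [hg', sub_add_cancel]
          rfl
      _ = V.opX (c' • g • v) := by rw [smul_smul, hg, ← smul_smul]; rfl
  have hY (v : V.carrier) : g • c⁻¹ • V.opY v = c'⁻¹ • V.opY (g • v) := by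
    calc g • c⁻¹ • V.opY v = c'⁻¹ • ((c' : Fin p → ℂ) * g) • c⁻¹ • V.opY v := by
          rw [eq_inv_smul_iff, mul_smul]
          rfl
      _ = c'⁻¹ • g' • c • c⁻¹ • V.opY v := by rw [← hg, mul_smul]; rfl
      _ = c'⁻¹ • V.opY (g • v) := by rw [smul_inv_smul, ← opY_orbit_smul]; rfl
  exact ⟨e, fun v => (congrArg (g • ·) (opX_twist V c v)).trans
      ((hX v).trans (opX_twist V c' _).symm),
    fun v => (congrArg (g • ·) (opY_twist V c v)).trans ((hY v).trans (opY_twist V c' _).symm)⟩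

variable (p) in
/-- The constant function with value `c` on the orbit. -/
noncomputable def constUnit (c : ℂˣ) : (Fin p → ℂ)ˣ := MulEquiv.piUnits.symm fun _ => c

-- The gauge transformation by `q^k ↦ c ^ (1 - k)`, `1 ≤ k ≤ p`.
theorem classAp_twist_constUnit (c : ℂˣ) :
    classAp t (twist V (constUnit p c)) = classAp t V := by
  have hiso : WeightModule.IsIso (twist V (constUnit p c)) (twist V (pointUnit p (c ^ p))) := by
    refine twist_isIso V (g := MulEquiv.piUnits.symm fun k => (c ^ (k - 1).val)⁻¹)
      (funext fun k => ?_)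
    change (((c ^ (k + 1 - 1).val)⁻¹ * c : ℂˣ) : ℂ) =
      (pointUnit p (c ^ p) : Fin p → ℂ) k * (((c ^ (k - 1).val)⁻¹ : ℂˣ) : ℂ)
    rw [add_sub_cancel_right, Units.val_mul, Units.val_inv_eq_inv_val, Units.val_inv_eq_inv_val,
      inv_mul_eq_iff_eq_mul₀ (Units.ne_zero _), mul_left_comm, ← mul_assoc,
      eq_mul_inv_iff_mul_eq₀ (Units.ne_zero _), coe_pointUnit]
    norm_cast
    rw [mul_comm, ← pow_succ]
    split_ifs with hk
    · rw [hk, zero_sub, val_neg_one_add_one, Fin.val_zero, pow_zero, Units.val_one, mul_one]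
    · rw [val_sub_one_add_one hk, one_mul]
  rw [classAp, GrothendieckRing.cls_eq_of_isIso rfl hiso]
  exact classAp_twist_pointUnit _

end ClassAp

section LiftAp

variable {E : Type*} [AddCommGroup E] [Module ℂ E]

theorem uIdeal_le_ker (L : GrothendieckRing (σ p) (ω p) (M p) →ₗ[ℂ] E)
    (hL : ∀ (t : M p) V ξ, L (GrothendieckRing.cls t (twist V (pointUnit p ξ))) =
      L (GrothendieckRing.cls t V)) :
    (uIdeal p).restrictScalars ℂ ≤ LinearMap.ker L := by
  have hu (ξ : ℂˣ) : L.comp (GrothendieckRing.mulMap (u p ξ)) = L :=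
    GrothendieckRing.hom_ext fun t V => (congrArg L (u_mul_cls ξ V)).trans (hL t V ξ)
  intro x hx
  refine Submodule.closure_induction (p := fun x _ => L x = 0) (map_zero L)
    (fun x y _ _ hx hy => by rw [map_add, hx, hy, add_zero]) ?_ hx
  rintro a _ ⟨ξ, rfl⟩
  rw [smul_eq_mul, mul_sub_one, map_sub, mul_comm, sub_eq_zero]
  exact DFunLike.congr_fun (hu ξ) a

/-- The linear map on `𝒜(p)` given by additive functions on modules which are invariant under
twists at one point. -/
noncomputable def liftAp (φ : ∀ t : M p, WeightModule (σ p) (ω p) (t : ℂ[T;T⁻¹]) → E)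
    (h : ∀ t U V W, WeightModule.IsExtension U V W → φ t V = φ t U + φ t W)
    (hφ : ∀ t V ξ, φ t (twist V (pointUnit p ξ)) = φ t V) : Ap p →ₗ[ℂ] E :=
  ((uIdeal p).restrictScalars ℂ).liftQ (GrothendieckRing.lift φ h) (uIdeal_le_ker _
    fun t V ξ => by rw [GrothendieckRing.lift_cls, GrothendieckRing.lift_cls, hφ]) ∘ₗ
    (Submodule.Quotient.restrictScalarsEquiv ℂ (uIdeal p)).symm.toLinearMap

theorem liftAp_classAp (φ : ∀ t : M p, WeightModule (σ p) (ω p) (t : ℂ[T;T⁻¹]) → E)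
    (h : ∀ t U V W, WeightModule.IsExtension U V W → φ t V = φ t U + φ t W)
    (hφ : ∀ t V ξ, φ t (twist V (pointUnit p ξ)) = φ t V) (t : M p)
    (V : WeightModule (σ p) (ω p) (t : ℂ[T;T⁻¹])) : liftAp φ h hφ (classAp t V) = φ t V :=
  GrothendieckRing.lift_cls φ h t V

end LiftAp

section WeightedShift

variable {ι K : Type*} [CommSemiring K]

/-- The weighted composition operator `φ ↦ a * (φ ∘ e)` on functions. -/
def weightedShift (e : ι → ι) (a : ι → K) : Module.End K (ι → K) :=
  LinearMap.mulLeft K a ∘ₗ LinearMap.funLeft K K e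

theorem weightedShift_apply (e : ι → ι) (a φ : ι → K) (k : ι) :
    weightedShift e a φ k = a k * φ (e k) := rfl

theorem weightedShift_pow_apply_eq_zero {e : ι → ι} {a : ι → K} {i n : ℕ} {k : ι}
    (hk : a (e^[i] k) = 0) (hin : i < n) (φ : ι → K) : (weightedShift e a ^ n) φ k = 0 := by
  obtain ⟨n, rfl⟩ := Nat.exists_eq_succ_of_ne_zero (Nat.ne_zero_of_lt hin)
  rw [Nat.succ_eq_add_one, pow_succ', Module.End.mul_apply, weightedShift_apply]
  induction i generalizing n k with
  | zero => rw [show a k = 0 from hk, zero_mul]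
  | succ i ih =>
    obtain ⟨n, rfl⟩ :=
      Nat.exists_eq_succ_of_ne_zero (Nat.ne_zero_of_lt (Nat.succ_lt_succ_iff.mp hin))
    rw [Nat.succ_eq_add_one, pow_succ', Module.End.mul_apply, weightedShift_apply,
      ih hk n (Nat.succ_lt_succ_iff.mp hin), mul_zero]

theorem isNilpotent_weightedShift [Finite ι] {e : ι → ι} {a : ι → K}
    (h : ∀ k, ∃ i, a (e^[i] k) = 0) : IsNilpotent (weightedShift e a) := by
  choose i hi using h
  obtain ⟨n, hn⟩ := (Set.finite_range i).bddAbove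
  refine ⟨n + 1, LinearMap.ext fun φ => funext fun k => ?_⟩
  exact weightedShift_pow_apply_eq_zero (hi k) (Nat.lt_succ_of_le (hn ⟨k, rfl⟩)) φ

theorem isNilpotent_weightedShift_add_one {a : Fin p → K} {k : Fin p} (hk : a k = 0) :
    IsNilpotent (weightedShift (· + 1) a) :=
  isNilpotent_weightedShift <| cyclic_induction_down (P := fun l => ∃ i, a ((· + 1)^[i] l) = 0) k
    ⟨0, hk⟩ fun _ ⟨i, hi⟩ => ⟨i + 1, hi⟩

theorem isNilpotent_weightedShift_sub_one {a : Fin p → K} {k : Fin p} (hk : a k = 0) :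
    IsNilpotent (weightedShift (· - 1) a) :=
  isNilpotent_weightedShift <| cyclic_induction_up (P := fun l => ∃ i, a ((· - 1)^[i] l) = 0) k
    ⟨0, hk⟩ fun l ⟨i, hi⟩ => ⟨i + 1, by rwa [Function.iterate_succ_apply, add_sub_cancel_right]⟩

end WeightedShift

section OrbitModule

variable {t : ℂ[T;T⁻¹]}

/-- The `A(t)`-module of functions on the orbit with `X φ = a * φ(· - 1)` and
`Y φ = b * φ(· + 1)`. -/
noncomputable def orbitModule (a b : Fin p → ℂ) (h : ∀ k, a (k + 1) * b k = evalOrbit p t k) :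
    WeightModule (σ p) (ω p) t :=
  WeightModule.ofOperators (OrbitSpace p) (weightedShift (· - 1) a).toAddMonoidHom
    (weightedShift (· + 1) b).toAddMonoidHom
    (fun f φ => funext fun k => by
      obtain ⟨k, rfl⟩ : ∃ j, k = j + 1 := ⟨k - 1, (sub_add_cancel k 1).symm⟩
      change a (k + 1) * (evalOrbit p f (k + 1 - 1) * φ (k + 1 - 1)) =
        evalOrbit p (σ p f) (k + 1) * (a (k + 1) * φ (k + 1 - 1))
      rw [evalOrbit_σ, add_sub_cancel_right, mul_left_comm])
    (fun f φ => funext fun k => by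
      change b k * (evalOrbit p f (k + 1) * φ (k + 1)) =
        evalOrbit p ((σ p).symm f) k * (b k * φ (k + 1))
      rw [← evalOrbit_σ p ((σ p).symm f), RingEquiv.apply_symm_apply, mul_left_comm])
    (fun φ => funext fun k => by
      change b k * (a (k + 1) * φ (k + 1 - 1)) = evalOrbit p t k * φ k
      rw [add_sub_cancel_right, ← h, ← mul_assoc, mul_comm (b k)])
    (fun φ => funext fun k => by
      obtain ⟨k, rfl⟩ : ∃ j, k = j + 1 := ⟨k - 1, (sub_add_cancel k 1).symm⟩
      change a (k + 1) * (b (k + 1 - 1) * φ (k + 1 - 1 + 1)) =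
        evalOrbit p (σ p t) (k + 1) * φ (k + 1)
      rw [evalOrbit_σ, sub_add_cancel, add_sub_cancel_right, ← h, mul_assoc])
    (isWeight_orbitSpace p)

section Generator

variable (a b : Fin p → ℂ) (h : ∀ k, a (k + 1) * b k = evalOrbit p t k)

theorem opX_orbitModule (φ : Fin p → ℂ) :
    (orbitModule a b h).opX φ = weightedShift (· - 1) a φ :=
  WeightModule.X_smul_ofOperators (OrbitSpace p) _ _ _ _ _ _ _ φ

theorem opY_orbitModule (φ : Fin p → ℂ) :
    (orbitModule a b h).opY φ = weightedShift (· + 1) b φ :=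
  WeightModule.Y_smul_ofOperators (OrbitSpace p) _ _ _ _ _ _ _ φ

/-- The constant function `1`, which generates `orbitModule a b h` as a module over the functions
on the orbit. -/
def orbitGen : (orbitModule a b h).carrier := (1 : Fin p → ℂ)

theorem smul_orbitGen (φ : Fin p → ℂ) : φ • orbitGen a b h = φ := by
  obtain ⟨f, rfl⟩ := evalOrbit_surjective p φ
  exact (evalOrbit_smul f _).trans (mul_one (M := Fin p → ℂ) _)

theorem opX_orbitGen : (orbitModule a b h).opX (orbitGen a b h) = a • orbitGen a b h :=
  (opX_orbitModule a b h 1).trans ((mul_one (M := Fin p → ℂ) a).trans (smul_orbitGen a b h a).symm)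

theorem opY_orbitGen : (orbitModule a b h).opY (orbitGen a b h) = b • orbitGen a b h :=
  (opY_orbitModule a b h 1).trans ((mul_one (M := Fin p → ℂ) b).trans (smul_orbitGen a b h b).symm)

variable {V : WeightModule (σ p) (ω p) t} {a b} {v : V.carrier}

theorem opX_smul_of_opX_eq (hX : V.opX v = a • v) (φ : Fin p → ℂ) :
    V.opX (φ • v) = weightedShift (· - 1) a φ • v := by
  rw [opX_orbit_smul, hX, smul_smul, mul_comm]
  rfl

theorem opY_smul_of_opY_eq (hY : V.opY v = b • v) (φ : Fin p → ℂ) :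
    V.opY (φ • v) = weightedShift (· + 1) b φ • v := by
  rw [opY_orbit_smul, hY, smul_smul, mul_comm]
  rfl

/-- The homomorphism `φ ↦ φ • v` from `orbitModule a b h` for a vector with `X v = a • v` and
`Y v = b • v`. -/
noncomputable def smulHom (hX : V.opX v = a • v) (hY : V.opY v = b • v) :
    (orbitModule a b h).carrier →ₗ[GWA (σ p) t] V.carrier :=
  WeightModule.homOfCommutes _ V
    { toFun := fun φ : Fin p → ℂ => φ • v
      map_add' := fun φ ψ => add_smul (R := Fin p → ℂ) φ ψ v
      map_smul' := fun f φ => (mul_smul (evalOrbit p f) φ v).trans (evalOrbit_smul f _) }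
    (fun φ => (congrArg (fun ψ : Fin p → ℂ => ψ • v) (opX_orbitModule a b h φ)).trans
      (opX_smul_of_opX_eq hX φ).symm)
    (fun φ => (congrArg (fun ψ : Fin p → ℂ => ψ • v) (opY_orbitModule a b h φ)).trans
      (opY_smul_of_opY_eq hY φ).symm)

theorem isNilpotent_of_generator (hv : ∀ w : V.carrier, ∃ φ : Fin p → ℂ, φ • v = w)
    {S : Module.End ℂ (Fin p → ℂ)} (hS : IsNilpotent S) {f : Module.End ℂ V.carrier}
    (hf : ∀ φ : Fin p → ℂ, f (φ • v) = S φ • v) : IsNilpotent f := by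
  obtain ⟨n, hn⟩ := hS
  have hpow (m : ℕ) (φ : Fin p → ℂ) : (f ^ m) (φ • v) = (S ^ m) φ • v := by
    induction m with
    | zero => rfl
    | succ m ih =>
      rw [pow_succ', Module.End.mul_apply, ih, hf, pow_succ', Module.End.mul_apply]
  refine ⟨n, LinearMap.ext fun w => ?_⟩
  obtain ⟨φ, rfl⟩ := hv w
  rw [hpow, hn, LinearMap.zero_apply, zero_smul, LinearMap.zero_apply]

theorem stableRank_act_X_of_generator {k : Fin p}
    (hv : ∀ w : V.carrier, ∃ φ : Fin p → ℂ, φ • v = w) (hX : V.opX v = a • v) (hk : a k = 0) :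
    stableRank (act V (GWA.X (σ p) t)) = 0 :=
  stableRank_of_isNilpotent
    (isNilpotent_of_generator hv (isNilpotent_weightedShift_sub_one hk) (opX_smul_of_opX_eq hX))

theorem stableRank_act_Y_of_generator {k : Fin p}
    (hv : ∀ w : V.carrier, ∃ φ : Fin p → ℂ, φ • v = w) (hY : V.opY v = b • v) (hk : b k = 0) :
    stableRank (act V (GWA.Y (σ p) t)) = 0 :=
  stableRank_of_isNilpotent
    (isNilpotent_of_generator hv (isNilpotent_weightedShift_add_one hk) (opY_smul_of_opY_eq hY))

end Generator

end OrbitModule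

section Component

variable {t : ℂ[T;T⁻¹]} {V W : WeightModule (σ p) (ω p) t}

theorem map_orbit_smul (f : V.carrier →ₗ[GWA (σ p) t] W.carrier) (a : Fin p → ℂ) (v : V.carrier) :
    f (a • v) = a • f v := by
  obtain ⟨r, rfl⟩ := evalOrbit_surjective p a
  rw [evalOrbit_smul, evalOrbit_smul, ← V.coeff_smul, map_smul, W.coeff_smul]

variable (V) in
/-- The projection of a weight module to its weight space at `q^k`. -/
noncomputable def component (k : Fin p) : Module.End ℂ V.carrier := orbitAct V (Pi.single k 1)

theorem orbit_smul_component (a : Fin p → ℂ) (k : Fin p) (v : V.carrier) :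
    a • component V k v = a k • component V k v := by
  change a • (Pi.single k 1 : Fin p → ℂ) • v = a k • (Pi.single k 1 : Fin p → ℂ) • v
  rw [smul_smul, ← smul_assoc, ← Pi.single_mul_right, mul_one, ← Pi.single_smul, smul_eq_mul,
    mul_one]

theorem component_orbit_smul (a : Fin p → ℂ) (k : Fin p) (v : V.carrier) :
    component V k (a • v) = a k • component V k v :=
  (smul_comm _ a v).trans (orbit_smul_component a k v)

theorem component_self (k : Fin p) (v : V.carrier) :
    component V k (component V k v) = component V k v := by
  refine (component_orbit_smul _ k v).trans ?_
  rw [Pi.single_eq_same, one_smul]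

theorem sum_component (v : V.carrier) : ∑ k, component V k v = v := by
  change ∑ k, (Pi.single k 1 : Fin p → ℂ) • v = v
  rw [← Finset.sum_smul, Finset.univ_sum_single (fun _ => 1), ← Pi.one_def, one_smul]

theorem eq_zero_iff_component {v : V.carrier} : v = 0 ↔ ∀ k, component V k v = 0 :=
  ⟨fun hv k => by rw [hv, map_zero], fun hv => by
    rw [← sum_component v, Finset.sum_eq_zero fun k _ => hv k]⟩

theorem opX_component (k : Fin p) (v : V.carrier) :
    V.opX (component V k v) = component V (k + 1) (V.opX v) := by
  refine (opX_orbit_smul _ v).trans (congrArg (· • V.opX v) (funext fun l => ?_))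
  simp only [Pi.single_apply, sub_eq_iff_eq_add]

theorem opY_component (k : Fin p) (v : V.carrier) :
    V.opY (component V (k + 1) v) = component V k (V.opY v) := by
  refine (opY_orbit_smul _ v).trans (congrArg (· • V.opY v) (funext fun l => ?_))
  simp only [Pi.single_apply, add_left_inj]

theorem orbit_smul_eq_zero_iff {a : Fin p → ℂ} {v : V.carrier} :
    a • v = 0 ↔ ∀ k, component V k v ≠ 0 → a k = 0 := by
  simp only [eq_zero_iff_component (v := a • v), component_orbit_smul, smul_eq_zero, ne_eq,
    or_iff_not_imp_right]

theorem component_ne_zero_of_opX_eq_self {v : V.carrier} (hv : v ≠ 0) (hX : V.opX v = v)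
    (k : Fin p) : component V k v ≠ 0 := by
  obtain ⟨l, hl⟩ := not_forall.mp (mt eq_zero_iff_component.mpr hv)
  refine cyclic_induction_down (P := fun k => component V k v ≠ 0) l hl (fun k hk h => hk ?_) k
  rw [← hX, ← opX_component, h, map_zero]

theorem component_ne_zero_of_opY_eq_self {v : V.carrier} (hv : v ≠ 0) (hY : V.opY v = v)
    (k : Fin p) : component V k v ≠ 0 := by
  obtain ⟨l, hl⟩ := not_forall.mp (mt eq_zero_iff_component.mpr hv)
  refine cyclic_induction_up (P := fun k => component V k v ≠ 0) l hl (fun k hk h => hk ?_) k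
  rw [← hY, ← opY_component, h, map_zero]

end Component

section SimpleModules

variable (t : ℂ[T;T⁻¹])

/-- The module of functions on the orbit on which `X` acts by translation. -/
noncomputable abbrev xModule : WeightModule (σ p) (ω p) t :=
  orbitModule 1 (evalOrbit p t) fun _ => one_mul _

/-- The module of functions on the orbit on which `Y` acts by translation. -/
noncomputable abbrev yModule : WeightModule (σ p) (ω p) t :=
  orbitModule (evalOrbit p (σ p t)) 1 fun k => by rw [Pi.one_apply, mul_one, evalOrbit_σ]

theorem yModule_one : yModule (p := p) 1 = xModule 1 := by
  unfold yModule xModule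
  congr 1 <;> simp only [map_one]

variable {t} {k : Fin p}

theorem evalOrbit_σ_mul_ite (hk : evalOrbit p t k = 0) (l : Fin p) :
    evalOrbit p (σ p t) (l + 1) * (if l = k then 0 else 1) = evalOrbit p t l := by
  rw [evalOrbit_σ]
  split_ifs with hl
  · rw [hl, hk, zero_mul]
  · rw [mul_one]

/-- The module of functions on the orbit on which `Y` acts by translation, except that `Y` maps
functions supported at `q^(k+1)` to `0`. -/
noncomputable abbrev brokenModule (hk : evalOrbit p t k = 0) : WeightModule (σ p) (ω p) t :=
  orbitModule (evalOrbit p (σ p t)) (fun l => if l = k then 0 else 1) (evalOrbit_σ_mul_ite hk)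

variable (t k) in
/-- The points `q^l`, `l = k, k - 1, …`, up to the first zero of `t` different from `q^k`, which is
excluded. -/
inductive Segment : Fin p → Prop
  | self : Segment k
  | step {l : Fin p} (hlk : l ≠ k) (hl : evalOrbit p t l ≠ 0) (h : Segment (l + 1)) : Segment l

theorem Segment.eq_of_zero {l : Fin p} (h : Segment t k l) (hl : evalOrbit p t l = 0) : l = k := by
  cases h with
  | self => rfl
  | step _ hl' _ => exact absurd hl hl'

theorem Segment.weightedShift_sub_one_eq_zero (hk : evalOrbit p t k = 0) {φ : Fin p → ℂ}
    (hφ : ∀ l, Segment t k l → φ l = 0) {l : Fin p} (hl : Segment t k l) :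
    weightedShift (· - 1) (evalOrbit p (σ p t)) φ l = 0 := by
  obtain ⟨l, rfl⟩ : ∃ j, l = j + 1 := ⟨l - 1, (sub_add_cancel l 1).symm⟩
  rw [weightedShift_apply, evalOrbit_σ, add_sub_cancel_right]
  by_cases htl : evalOrbit p t l = 0
  · rw [htl, zero_mul]
  · rw [hφ l (.step (fun h => htl (h ▸ hk)) htl hl), mul_zero]

theorem Segment.weightedShift_add_one_eq_zero {φ : Fin p → ℂ}
    (hφ : ∀ l, Segment t k l → φ l = 0) {l : Fin p} (hl : Segment t k l) :
    weightedShift (· + 1) (fun l => if l = k then 0 else 1) φ l = 0 := by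
  rw [weightedShift_apply]
  cases hl with
  | self => rw [if_pos rfl, zero_mul]
  | step _ _ h => rw [hφ _ h, mul_zero]

/-- The submodule of functions vanishing on the segment ending at `q^k`. -/
noncomputable def segmentKernel (hk : evalOrbit p t k = 0) :
    Submodule (GWA (σ p) t) (brokenModule hk).carrier :=
  (brokenModule hk).submoduleOfStable
    { carrier := {φ : Fin p → ℂ | ∀ l, Segment t k l → φ l = 0}
      zero_mem' := fun _ _ => rfl
      add_mem' := fun {φ ψ} hφ hψ l hl => by
        change (φ : Fin p → ℂ) l + (ψ : Fin p → ℂ) l = 0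
        rw [hφ l hl, hψ l hl, add_zero]
      smul_mem' := fun f φ hφ l hl => by
        change evalOrbit p f l * (φ : Fin p → ℂ) l = 0
        rw [hφ l hl, mul_zero] }
    (fun φ hφ l hl => (congrFun (opX_orbitModule _ _ (evalOrbit_σ_mul_ite hk) φ) l).trans
      (Segment.weightedShift_sub_one_eq_zero hk hφ hl))
    (fun φ hφ l hl => (congrFun (opY_orbitModule _ _ (evalOrbit_σ_mul_ite hk) φ) l).trans
      (Segment.weightedShift_add_one_eq_zero hφ hl))

/-- The simple module with weights in the segment ending at the zero `q^k` of `t`. -/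
noncomputable abbrev segmentModule (hk : evalOrbit p t k = 0) : WeightModule (σ p) (ω p) t :=
  (brokenModule hk).quotient (segmentKernel hk)

/-- The class of the constant function `1`. -/
noncomputable def segmentGen (hk : evalOrbit p t k = 0) : (segmentModule hk).carrier :=
  (brokenModule hk).quotientMk (segmentKernel hk) (orbitGen _ _ _)

variable (hk : evalOrbit p t k = 0)

theorem exists_smul_segmentGen (w : (segmentModule hk).carrier) :
    ∃ φ : Fin p → ℂ, φ • segmentGen hk = w := by
  obtain ⟨φ, rfl⟩ := WeightModule.quotientMk_surjective w
  exact ⟨φ, (map_orbit_smul _ _ _).symm.trans (congrArg _ (smul_orbitGen _ _ _ φ))⟩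

theorem opX_segmentGen :
    (segmentModule hk).opX (segmentGen hk) = evalOrbit p (σ p t) • segmentGen hk := by
  refine (LinearMap.map_smul _ _ _).symm.trans ((congrArg _ (opX_orbitGen _ _ _)).trans ?_)
  exact map_orbit_smul _ _ _

theorem opY_segmentGen : (segmentModule hk).opY (segmentGen hk) =
    (fun l => if l = k then 0 else 1 : Fin p → ℂ) • segmentGen hk := by
  refine (LinearMap.map_smul _ _ _).symm.trans ((congrArg _ (opY_orbitGen _ _ _)).trans ?_)
  exact map_orbit_smul _ _ _

theorem smul_segmentGen_eq_zero {φ : Fin p → ℂ} :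
    φ • segmentGen hk = 0 ↔ ∀ l, Segment t k l → φ l = 0 := by
  rw [segmentGen, ← map_orbit_smul, smul_orbitGen]
  exact WeightModule.quotientMk_eq_zero

theorem stableRank_component_segmentModule :
    stableRank (component (segmentModule hk) k) ≠ 0 := by
  refine stableRank_ne_zero_of_apply_eq_self (v := component _ k (segmentGen hk)) (fun h => ?_)
    (component_self k _)
  have hone : (Pi.single k 1 : Fin p → ℂ) k = 0 := (smul_segmentGen_eq_zero hk).mp h k .self
  exact one_ne_zero ((Pi.single_eq_same k 1).symm.trans hone)

theorem stableRank_component_segmentModule_of_ne {l : Fin p} (hl : evalOrbit p t l = 0)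
    (hlk : l ≠ k) : stableRank (component (segmentModule hk) l) = 0 := by
  have hzero : component (segmentModule hk) l (segmentGen hk) = 0 := by
    refine (smul_segmentGen_eq_zero hk).mpr fun j hj => Pi.single_eq_of_ne ?_ _
    rintro rfl
    exact hlk (hj.eq_of_zero hl)
  have h : component (segmentModule hk) l = 0 := LinearMap.ext fun w => by
    obtain ⟨φ, rfl⟩ := exists_smul_segmentGen hk w
    rw [component_orbit_smul, hzero, smul_zero, LinearMap.zero_apply]
  rw [h]
  exact stableRank_of_isNilpotent .zero

theorem stableRank_act_X_segmentModule :
    stableRank (act (segmentModule hk) (GWA.X (σ p) t)) = 0 :=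
  stableRank_act_X_of_generator (k := k + 1) (exists_smul_segmentGen hk) (opX_segmentGen hk)
    (by rw [evalOrbit_σ, hk])

theorem stableRank_act_Y_segmentModule :
    stableRank (act (segmentModule hk) (GWA.Y (σ p) t)) = 0 :=
  stableRank_act_Y_of_generator (exists_smul_segmentGen hk) (opY_segmentGen hk) (if_pos rfl)

include hk in
theorem stableRank_act_X_yModule : stableRank (act (yModule t) (GWA.X (σ p) t)) = 0 :=
  stableRank_act_X_of_generator (k := k + 1) (fun w => ⟨w, smul_orbitGen _ _ _ w⟩)
    (opX_orbitGen _ _ _) (by rw [evalOrbit_σ, hk])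

include hk in
theorem stableRank_act_Y_xModule : stableRank (act (xModule t) (GWA.Y (σ p) t)) = 0 :=
  stableRank_act_Y_of_generator (fun w => ⟨w, smul_orbitGen _ _ _ w⟩) (opY_orbitGen _ _ _) hk

theorem stableRank_act_X_xModule : stableRank (act (xModule t) (GWA.X (σ p) t)) ≠ 0 :=
  stableRank_ne_zero_of_apply_eq_self (v := orbitGen _ _ _)
    (fun h => one_ne_zero (congrFun h 0)) ((opX_orbitGen _ _ _).trans (one_smul _ _))

theorem stableRank_act_Y_yModule : stableRank (act (yModule t) (GWA.Y (σ p) t)) ≠ 0 :=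
  stableRank_ne_zero_of_apply_eq_self (v := orbitGen _ _ _)
    (fun h => one_ne_zero (congrFun h 0)) ((opY_orbitGen _ _ _).trans (one_smul _ _))

end SimpleModules

section Embedding

variable {t : ℂ[T;T⁻¹]} {V : WeightModule (σ p) (ω p) t}

theorem exists_injective_xModule {v : V.carrier} (hv : v ≠ 0) (hX : V.opX v = v) :
    ∃ f : (xModule (p := p) t).carrier →ₗ[GWA (σ p) t] V.carrier, Function.Injective f := by
  have hY : V.opY v = evalOrbit p t • v := by
    rw [evalOrbit_smul, ← V.opY_opX, hX]
  refine ⟨smulHom _ (hX.trans (one_smul (Fin p → ℂ) v).symm) hY,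
    (injective_iff_map_eq_zero _).mpr fun φ hφ => funext fun k => ?_⟩
  exact (orbit_smul_eq_zero_iff (a := φ) (v := v)).mp hφ k
    (component_ne_zero_of_opX_eq_self hv hX k)

theorem exists_injective_yModule {v : V.carrier} (hv : v ≠ 0) (hY : V.opY v = v) :
    ∃ f : (yModule (p := p) t).carrier →ₗ[GWA (σ p) t] V.carrier, Function.Injective f := by
  have hX : V.opX v = evalOrbit p (σ p t) • v := by
    rw [evalOrbit_smul, ← V.opX_opY, hY]
  refine ⟨smulHom _ hX (hY.trans (one_smul (Fin p → ℂ) v).symm),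
    (injective_iff_map_eq_zero _).mpr fun φ hφ => funext fun k => ?_⟩
  exact (orbit_smul_eq_zero_iff (a := φ) (v := v)).mp hφ k
    (component_ne_zero_of_opY_eq_self hv hY k)

variable (V) in
/-- A string of weight vectors `u l`, starting at `q^k` and moved down by `Y`, in which no vector
but the first one is killed by `X` unless it is zero. -/
structure IsString (k : Fin p) (u : Fin p → V.carrier) : Prop where
  component_eq (l : Fin p) : component V l (u l) = u l
  opX_eq (l : Fin p) : V.opX (u l) = evalOrbit p t l • u (l + 1)
  opY_eq (l : Fin p) : V.opY (u (l + 1)) = if l = k then 0 else u l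
  ne_zero : u k ≠ 0
  eq_zero (l : Fin p) : l ≠ k → V.opX (u l) = 0 → u l = 0

namespace IsString

variable {k : Fin p} {u : Fin p → V.carrier} (hu : IsString V k u)

include hu

theorem ne_zero_iff (l : Fin p) : u l ≠ 0 ↔ Segment t k l := by
  refine ⟨fun hl => ?_, fun hl => ?_⟩
  · refine cyclic_induction_down (P := fun l => u l ≠ 0 → Segment t k l) k (fun _ => .self)
      (fun l ih hl => ?_) l hl
    rcases eq_or_ne l k with rfl | hlk
    · exact .self
    refine .step hlk (fun ht => hl (hu.eq_zero l hlk ?_)) (ih fun h => hl ?_)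
    · rw [hu.opX_eq, ht, zero_smul]
    · rw [← if_neg (c := l = k) (t := 0) (e := u l) hlk, ← hu.opY_eq, h, map_zero]
  · induction hl with
    | self => exact hu.ne_zero
    | step _ ht _ ih =>
      intro hl
      refine smul_ne_zero ht ih ?_
      rw [← hu.opX_eq, hl, map_zero]

theorem component_apply (l j : Fin p) : component V l (u j) = if l = j then u j else 0 := by
  split_ifs with h
  · rw [h, hu.component_eq]
  · rw [← hu.component_eq j]
    refine (orbit_smul_component _ j _).trans ?_
    rw [Pi.single_eq_of_ne (Ne.symm h), zero_smul]

theorem component_sum (l : Fin p) : component V l (∑ j, u j) = u l := by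
  rw [map_sum]
  simp only [hu.component_apply, Finset.sum_ite_eq, Finset.mem_univ, if_true]

theorem orbit_smul_sum (a : Fin p → ℂ) : a • ∑ l, u l = ∑ l, a l • u l := by
  rw [Finset.smul_sum]
  refine Finset.sum_congr rfl fun l _ => ?_
  rw [← hu.component_eq l, orbit_smul_component]

theorem opX_sum : V.opX (∑ l, u l) = evalOrbit p (σ p t) • ∑ l, u l := by
  rw [map_sum, hu.orbit_smul_sum,
    ← Equiv.sum_comp (Equiv.addRight 1) fun l => evalOrbit p (σ p t) l • u l]
  exact Finset.sum_congr rfl fun l _ => by rw [Equiv.coe_addRight, hu.opX_eq, evalOrbit_σ]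

theorem opY_sum :
    V.opY (∑ l, u l) = (fun l => if l = k then 0 else 1 : Fin p → ℂ) • ∑ l, u l := by
  rw [← Equiv.sum_comp (Equiv.addRight 1), map_sum, Equiv.sum_comp, hu.orbit_smul_sum]
  refine Finset.sum_congr rfl fun l _ => ?_
  rw [Equiv.coe_addRight, hu.opY_eq, ite_smul, zero_smul, one_smul]

theorem exists_injective_segmentModule (hk : evalOrbit p t k = 0) :
    ∃ f : (segmentModule hk).carrier →ₗ[GWA (σ p) t] V.carrier, Function.Injective f := by
  refine WeightModule.exists_injective_of_ker_eq
    (smulHom (evalOrbit_σ_mul_ite hk) hu.opX_sum hu.opY_sum) (Submodule.ext fun φ => ?_)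
  refine orbit_smul_eq_zero_iff.trans (forall_congr' fun l => ?_)
  rw [hu.component_sum, hu.ne_zero_iff]

end IsString

end Embedding

section HighestWeight

variable {t : ℂ[T;T⁻¹]} {V : WeightModule (σ p) (ω p) t}

variable (V) in
/-- The weight vectors of a weight module, including `0`. -/
def IsWeightVector (v : V.carrier) : Prop := ∃ k, component V k v = v

theorem IsWeightVector.opY_iterate {v : V.carrier} (hv : IsWeightVector V v) (n : ℕ) :
    IsWeightVector V (V.opY^[n] v) := by
  induction n with
  | zero => exact hv
  | succ n ih =>
    obtain ⟨k, hk⟩ := ih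
    refine ⟨k - 1, ?_⟩
    rw [Function.iterate_succ_apply', ← opY_component, sub_add_cancel, hk]

theorem exists_weightVector_opX_eq_zero [Nontrivial V.carrier]
    (hX : IsNilpotent (act V (GWA.X (σ p) t))) :
    ∃ w, IsWeightVector V w ∧ w ≠ 0 ∧ V.opX w = 0 := by
  have hker : LinearMap.ker (act V (GWA.X (σ p) t)) ≠ ⊥ := fun h =>
    hX.not_isUnit ((LinearMap.isUnit_iff_ker_eq_bot _).mpr h)
  obtain ⟨v, hXv, hv⟩ := Submodule.exists_mem_ne_zero_of_ne_bot hker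
  obtain ⟨k, hk⟩ := not_forall.mp (mt eq_zero_iff_component.mpr hv)
  refine ⟨component V k v, ⟨k, component_self k v⟩, hk, ?_⟩
  rw [opX_component, show V.opX v = 0 from hXv, map_zero]

theorem exists_primitive_vector [Nontrivial V.carrier]
    (hX : IsNilpotent (act V (GWA.X (σ p) t))) (hY : IsNilpotent (act V (GWA.Y (σ p) t))) :
    ∃ w, IsWeightVector V w ∧ w ≠ 0 ∧ V.opX w = 0 ∧
      ∀ n, V.opX (V.opY^[n + 1] w) = 0 → V.opY^[n + 1] w = 0 := by
  classical
  have hmin : ∃ n, ∃ w, IsWeightVector V w ∧ w ≠ 0 ∧ V.opX w = 0 ∧ V.opY^[n] w = 0 := by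
    obtain ⟨w, hwt, hw, hXw⟩ := exists_weightVector_opX_eq_zero hX
    obtain ⟨n, hn⟩ := hY
    refine ⟨n, w, hwt, hw, hXw, ?_⟩
    exact (Module.End.pow_apply _ n w).symm.trans (LinearMap.congr_fun hn w)
  obtain ⟨w, hwt, hw, hXw, hYw⟩ := Nat.find_spec hmin
  refine ⟨w, hwt, hw, hXw, fun m hm => by_contra fun hne => ?_⟩
  obtain ⟨n, hn⟩ : ∃ n, Nat.find hmin = n + 1 :=
    Nat.exists_eq_succ_of_ne_zero fun h => hw (by rwa [h] at hYw)
  refine Nat.find_min hmin (show n < Nat.find hmin by omega) ⟨_, hwt.opY_iterate _, hne, hm, ?_⟩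
  rw [← Function.iterate_add_apply, ← add_assoc, Nat.add_right_comm, ← hn, add_comm,
    Function.iterate_add_apply, hYw, iterate_map_zero]

theorem smul_of_component_eq_self {k : Fin p} {v : V.carrier} (hv : component V k v = v)
    (f : ℂ[T;T⁻¹]) : f • v = evalOrbit p f k • v := by
  rw [← evalOrbit_smul, ← hv, orbit_smul_component]

theorem evalOrbit_eq_zero_of_opX_eq_zero {k : Fin p} {w : V.carrier} (hk : component V k w = w)
    (hw : w ≠ 0) (hXw : V.opX w = 0) : evalOrbit p t k = 0 := by
  refine (smul_eq_zero.mp ?_).resolve_right hw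
  rw [← smul_of_component_eq_self hk, ← V.opY_opX, hXw, map_zero]

theorem exists_isString [Nontrivial V.carrier]
    (hX : IsNilpotent (act V (GWA.X (σ p) t))) (hY : IsNilpotent (act V (GWA.Y (σ p) t))) :
    ∃ k, evalOrbit p t k = 0 ∧ ∃ u, IsString V k u := by
  obtain ⟨w, ⟨k, hk⟩, hw, hXw, hprim⟩ := exists_primitive_vector hX hY
  have htk := evalOrbit_eq_zero_of_opX_eq_zero hk hw hXw
  let u (l : Fin p) : V.carrier := V.opY^[(k - l).val] w
  have huk : u k = w := by simp only [u, sub_self, Fin.val_zero, Function.iterate_zero, id]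
  have hstep {l : Fin p} (hl : l ≠ k) : u l = V.opY (u (l + 1)) := by
    simp only [u]
    rw [← Function.iterate_succ_apply' V.opY, ← sub_sub, Nat.succ_eq_add_one,
      val_sub_one_add_one (sub_ne_zero.mpr hl.symm)]
  have hcomp (l : Fin p) : component V l (u l) = u l := by
    refine cyclic_induction_down (P := fun l => component V l (u l) = u l) k (by rwa [huk])
      (fun l ih => ?_) l
    rcases eq_or_ne l k with rfl | hl
    · rwa [huk]
    · rw [hstep hl, ← opY_component, ih]
  have hXu (l : Fin p) : V.opX (u l) = evalOrbit p t l • u (l + 1) := by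
    rcases eq_or_ne l k with rfl | hl
    · rw [huk, hXw, htk, zero_smul]
    · rw [hstep hl, V.opX_opY, smul_of_component_eq_self (hcomp _), evalOrbit_σ]
  have hzero (l : Fin p) (hl : l ≠ k) (h : V.opX (u l) = 0) : u l = 0 := by
    have hval := val_sub_one_add_one (sub_ne_zero.mpr hl.symm)
    simp only [u, ← hval] at h ⊢
    exact hprim _ h
  have hYu : V.opY (u (k + 1)) = 0 := by
    have hp : V.opY (u (k + 1)) = V.opY^[(-1 : Fin p).val + 1] w := by
      simp only [u, sub_add_cancel_left, Function.iterate_succ_apply']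
    rw [hp]
    refine hprim _ ?_
    rw [← hp, V.opX_opY, smul_of_component_eq_self (hcomp _), evalOrbit_σ, htk, zero_smul]
  refine ⟨k, htk, u, hcomp, hXu, fun l => ?_, by rwa [huk], hzero⟩
  split_ifs with hl
  · rw [hl, hYu]
  · exact (hstep hl).symm

end HighestWeight

section Spanning

variable {t : ℂ[T;T⁻¹]} (V : WeightModule (σ p) (ω p) t)

theorem constUnit_smul (c : ℂˣ) (v : V.carrier) : constUnit p c • v = (c : ℂ) • v := by
  have hC : (constUnit p c : Fin p → ℂ) = evalOrbit p (C (c : ℂ)) :=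
    funext fun k => (evalOrbit_C p c k).symm
  exact (congrArg (· • v) hC).trans (evalOrbit_smul _ v)

theorem opX_twist_constUnit (c : ℂˣ) (v : V.carrier) :
    (twist V (constUnit p c)).opX v = ((c : ℂ) • V.opX v : V.carrier) := by
  rw [opX_twist, constUnit_smul]
  exact (act V (GWA.X (σ p) t)).map_smul _ v

theorem opY_twist_constUnit (c : ℂˣ) (v : V.carrier) :
    (twist V (constUnit p c)).opY v = ((c⁻¹ : ℂˣ) : ℂ) • V.opY v := by
  rw [opY_twist, ← constUnit_smul, constUnit, constUnit, ← map_inv]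
  rfl

variable (t) in
/-- The modules which span the classes of `A(t)`-modules in `𝒜(p)`. -/
noncomputable def simpleModule :
    Bool ⊕ {k : Fin p // evalOrbit p t k = 0} → WeightModule (σ p) (ω p) t
  | .inl true => xModule t
  | .inl false => yModule t
  | .inr k => segmentModule k.2

instance nontrivial_simpleModule (i : Bool ⊕ {k : Fin p // evalOrbit p t k = 0}) :
    Nontrivial (simpleModule t i).carrier :=
  match i with
  | .inl true => show Nontrivial (xModule t).carrier from
      nontrivial_of_stableRank_ne_zero stableRank_act_X_xModule
  | .inl false => show Nontrivial (yModule t).carrier from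
      nontrivial_of_stableRank_ne_zero stableRank_act_Y_yModule
  | .inr k => show Nontrivial (segmentModule k.2).carrier from
      nontrivial_of_stableRank_ne_zero (stableRank_component_segmentModule k.2)

theorem exists_injective_simpleModule [Nontrivial V.carrier] :
    ∃ (c : ℂˣ) (i : Bool ⊕ {k : Fin p // evalOrbit p t k = 0})
      (f : (simpleModule t i).carrier →ₗ[GWA (σ p) t] (twist V (constUnit p c)).carrier),
      Function.Injective f := by
  by_cases hX : IsNilpotent (act V (GWA.X (σ p) t))
  · by_cases hY : IsNilpotent (act V (GWA.Y (σ p) t))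
    · have hX' : act (twist V (constUnit p 1)) (GWA.X (σ p) t) = act V (GWA.X (σ p) t) :=
        LinearMap.ext fun v => (opX_twist_constUnit V 1 v).trans (one_smul ℂ _)
      have hY' : act (twist V (constUnit p 1)) (GWA.Y (σ p) t) = act V (GWA.Y (σ p) t) :=
        LinearMap.ext fun v => (opY_twist_constUnit V 1 v).trans
          (by rw [inv_one]; exact one_smul ℂ _)
      have : Nontrivial (twist V (constUnit p 1)).carrier := ‹Nontrivial V.carrier›
      obtain ⟨k, hk, u, hu⟩ := exists_isString (V := twist V (constUnit p 1))
        (hX' ▸ hX) (hY' ▸ hY)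
      exact ⟨1, .inr ⟨k, hk⟩, hu.exists_injective_segmentModule hk⟩
    · obtain ⟨c, v, hc, hv, hcv⟩ := exists_eigenvector_of_not_isNilpotent hY
      refine ⟨Units.mk0 c hc, .inl false, exists_injective_yModule hv
        ((opY_twist_constUnit V _ v).trans ((congrArg _ hcv).trans ?_))⟩
      rw [Units.val_inv_eq_inv_val, Units.val_mk0, inv_smul_smul₀ hc]
  · obtain ⟨c, v, hc, hv, hcv⟩ := exists_eigenvector_of_not_isNilpotent hX
    refine ⟨(Units.mk0 c hc)⁻¹, .inl true, exists_injective_xModule hv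
      ((opX_twist_constUnit V _ v).trans ((congrArg _ hcv).trans ?_))⟩
    rw [Units.val_inv_eq_inv_val, Units.val_mk0, inv_smul_smul₀ hc]

/-- The classes in `𝒜(p)` of the modules `simpleModule t i`. -/
noncomputable def simpleClass (t : M p) (i : Bool ⊕ {k : Fin p // evalOrbit p t k = 0}) : Ap p :=
  classAp t (simpleModule t i)

theorem classAp_mem_span_simpleClass (t : M p) (V : WeightModule (σ p) (ω p) (t : ℂ[T;T⁻¹])) :
    classAp t V ∈ Submodule.span ℂ (Set.range (simpleClass t)) := by
  induction hn : Module.finrank ℂ V.carrier using Nat.strong_induction_on generalizing V with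
  | _ n ih =>
    rcases subsingleton_or_nontrivial V.carrier with _ | _
    · rw [classAp_eq_zero]
      exact zero_mem _
    obtain ⟨c, i, f, hf⟩ := exists_injective_simpleModule V
    have hext := WeightModule.isExtension_quotient_range f hf
    have hlt : Module.finrank ℂ ((twist V (constUnit p c)).quotient (LinearMap.range f)).carrier <
        n := by
      refine (Nat.lt_add_of_pos_left (Module.finrank_pos (R := ℂ)
        (M := (simpleModule (t : ℂ[T;T⁻¹]) i).carrier))).trans_eq ?_
      exact (finrank_of_isExtension hext).symm.trans hn
    rw [← classAp_twist_constUnit c, classAp_eq_add hext]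
    exact add_mem (Submodule.subset_span ⟨i, rfl⟩) (ih _ hlt _ rfl)

end Spanning

section ExponentMonoid

omit [NeZero p] in
theorem coe_toM (d : Multiplicative (Fin p →₀ ℕ)) :
    (toM p d : ℂ[T;T⁻¹]) = ((Finsupp.toMultiset d.toAdd).map (lin p)).prod := by
  rw [Finsupp.toMultiset_map, Finsupp.prod_toMultiset, Finsupp.prod_mapDomain_index
    (fun _ => pow_zero _) (fun _ _ _ => pow_add _ _ _),
    Finsupp.prod_fintype _ _ fun _ => pow_zero _]
  rfl

omit [NeZero p] in
theorem toM_surjective : Function.Surjective (toM p) := by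
  have hrange : M p ≤ MonoidHom.mrange ((M p).subtype.comp (toM p)) := by
    refine Submonoid.closure_le.mpr ?_
    rintro _ ⟨k, rfl⟩
    refine ⟨Multiplicative.ofAdd (Finsupp.single k 1), ?_⟩
    rw [MonoidHom.comp_apply, Submonoid.subtype_apply, coe_toM, toAdd_ofAdd,
      Finsupp.toMultiset_single, one_smul, Multiset.map_singleton, Multiset.prod_singleton]
  rintro ⟨t, ht⟩
  obtain ⟨d, hd⟩ := hrange ht
  exact ⟨d, Subtype.ext hd⟩

theorem q_pow_injective : Function.Injective fun k : Fin p => (q p : ℂ) ^ (k : ℕ) :=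
  fun a b hab => Fin.ext ((isPrimitiveRoot_q p).pow_inj a.2 b.2 hab)

theorem toM_injective : Function.Injective (toM p) := by
  let roots (d : Multiplicative (Fin p →₀ ℕ)) : Multiset ℂ :=
    Multiset.map (fun k : Fin p => (q p : ℂ) ^ (k : ℕ)) (Finsupp.toMultiset d.toAdd)
  have hlin (k : Fin p) : lin p k =
      Polynomial.toLaurent (Polynomial.X - Polynomial.C ((q p : ℂ) ^ (k : ℕ))) := by
    rw [map_sub, Polynomial.toLaurent_X, Polynomial.toLaurent_C, lin]
  have htoM d : (toM p d : ℂ[T;T⁻¹]) =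
      Polynomial.toLaurent ((roots d).map fun a => Polynomial.X - Polynomial.C a).prod := by
    rw [coe_toM, map_multiset_prod, Multiset.map_map, Multiset.map_map]
    exact congrArg _ (Multiset.map_congr rfl fun k _ => hlin k)
  intro d e hde
  have hroots : roots d = roots e := by
    rw [← Polynomial.roots_multiset_prod_X_sub_C (roots d),
      ← Polynomial.roots_multiset_prod_X_sub_C (roots e),
      Polynomial.toLaurent_injective ((htoM d).symm.trans ((congrArg _ hde).trans (htoM e)))]
  exact Multiplicative.toAdd.injective
    (Multiset.toFinsupp.symm.injective (Multiset.map_injective q_pow_injective hroots))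

theorem evalOrbit_lin_eq_zero_iff {k l : Fin p} : evalOrbit p (lin p l) k = 0 ↔ l = k := by
  rw [lin, map_sub, Pi.sub_apply, evalOrbit_T, evalOrbit_C, sub_eq_zero, q_pow_injective.eq_iff,
    eq_comm]

theorem evalOrbit_toM_eq_zero_iff (d : Multiplicative (Fin p →₀ ℕ)) (k : Fin p) :
    evalOrbit p (toM p d) k = 0 ↔ k ∈ d.toAdd.support := by
  change evalOrbit p (∏ l, lin p l ^ d.toAdd l) k = 0 ↔ _
  rw [map_prod, Finset.prod_apply, Finset.prod_eq_zero_iff]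
  simp only [map_pow, Pi.pow_apply, pow_eq_zero_iff', evalOrbit_lin_eq_zero_iff, Finset.mem_univ,
    true_and, exists_eq_left, Finsupp.mem_support_iff]

end ExponentMonoid

section Components

theorem classAp_mem_piece {d : Fin p →₀ ℕ} {t : M p} (h : toM p (Multiplicative.ofAdd d) = t)
    (V : WeightModule (σ p) (ω p) (t : ℂ[T;T⁻¹])) : classAp t V ∈ piece p d := by
  subst h
  exact ⟨_, ⟨_, rfl⟩, rfl⟩

theorem piece_le {d : Fin p →₀ ℕ} {S : Submodule ℂ (Ap p)}
    (hS : ∀ V, classAp (toM p (Multiplicative.ofAdd d)) V ∈ S) : piece p d ≤ S := by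
  have hzero : S.mkQ ∘ₗ (toAp p).toLinearMap ∘ₗ GrothendieckRing.incl (σ p) (ω p) _ = 0 :=
    K0.linearMap_ext fun V => (Submodule.Quotient.mk_eq_zero S).mpr (hS V)
  rintro _ ⟨_, ⟨x, rfl⟩, rfl⟩
  exact (Submodule.Quotient.mk_eq_zero S).mp (LinearMap.congr_fun hzero x)

theorem piece_eq_span_classAp (d : Fin p →₀ ℕ) : piece p d =
    Submodule.span ℂ (Set.range (classAp (toM p (Multiplicative.ofAdd d)))) := by
  refine le_antisymm (piece_le fun V => Submodule.subset_span ⟨V, rfl⟩) (Submodule.span_le.mpr ?_)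
  rintro _ ⟨V, rfl⟩
  exact classAp_mem_piece rfl V

theorem piece_eq_span_simpleClass (d : Fin p →₀ ℕ) : piece p d =
    Submodule.span ℂ (Set.range (simpleClass (toM p (Multiplicative.ofAdd d)))) := by
  refine le_antisymm (piece_le (classAp_mem_span_simpleClass _)) (Submodule.span_le.mpr ?_)
  rintro _ ⟨i, rfl⟩
  exact classAp_mem_piece rfl _

instance finite_piece (d : Fin p →₀ ℕ) : Module.Finite ℂ (piece p d) := by
  rw [piece_eq_span_simpleClass]
  exact Module.Finite.span_of_finite ℂ (Set.finite_range _)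

theorem eq_zero_of_additive {ι : Type*} [Fintype ι] {t : M p}
    {V : ι → WeightModule (σ p) (ω p) (t : ℂ[T;T⁻¹])} {g : ι → ℂ}
    (hg : ∑ i, g i • classAp t (V i) = 0)
    (r : ∀ t : M p, WeightModule (σ p) (ω p) (t : ℂ[T;T⁻¹]) → ℕ)
    (hadd : ∀ t U V W, WeightModule.IsExtension U V W → r t V = r t U + r t W)
    (htwist : ∀ t V ξ, r t (twist V (pointUnit p ξ)) = r t V)
    {i : ι} (hi : r t (V i) ≠ 0) (hne : ∀ j ≠ i, r t (V j) = 0) : g i = 0 := by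
  let L : Ap p →ₗ[ℂ] ℂ := liftAp (fun t V => (r t V : ℂ))
    (fun t U V W h => by rw [hadd t U V W h, Nat.cast_add]) fun t V ξ => by rw [htwist]
  have hL : ∑ j, g j * r t (V j) = 0 := by
    simpa only [L, map_sum, map_smul, map_zero, liftAp_classAp, smul_eq_mul] using congrArg L hg
  rw [Finset.sum_eq_single i (fun j _ hj => by rw [hne j hj, Nat.cast_zero, mul_zero])
    fun h => absurd (Finset.mem_univ i) h] at hL
  exact (mul_eq_zero.mp hL).resolve_right (Nat.cast_ne_zero.mpr hi)

theorem linearIndependent_simpleClass {t : M p} {k₀ : Fin p} (hk₀ : evalOrbit p t k₀ = 0) :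
    LinearIndependent ℂ (simpleClass t) := by
  rw [Fintype.linearIndependent_iff]
  intro g hg
  have hx : g (.inl true) = 0 := by
    refine eq_zero_of_additive hg (fun t V => stableRank (act V (GWA.X (σ p) (t : ℂ[T;T⁻¹]))))
      (fun _ _ _ _ h => stableRank_act_of_isExtension h _)
      (fun _ V _ => stableRank_act_X_twist V _) stableRank_act_X_xModule ?_
    rintro ((_ | _) | l) hl
    exacts [stableRank_act_X_yModule hk₀, absurd rfl hl, stableRank_act_X_segmentModule l.2]
  have hy : g (.inl false) = 0 := by
    refine eq_zero_of_additive hg (fun t V => stableRank (act V (GWA.Y (σ p) (t : ℂ[T;T⁻¹]))))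
      (fun _ _ _ _ h => stableRank_act_of_isExtension h _)
      (fun _ V _ => stableRank_act_Y_twist V _) stableRank_act_Y_yModule ?_
    rintro ((_ | _) | l) hl
    exacts [absurd rfl hl, stableRank_act_Y_xModule hk₀, stableRank_act_Y_segmentModule l.2]
  rw [Fintype.sum_sum_type, Fintype.sum_bool, hx, hy, zero_smul, zero_smul, zero_add,
    zero_add] at hg
  rintro ((_ | _) | k)
  · exact hy
  · exact hx
  · exact eq_zero_of_additive (V := fun l : {l // evalOrbit p t l = 0} => segmentModule l.2)
      (g := fun l => g (.inr l)) hg (fun _ V => stableRank (component V k))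
      (fun _ _ _ _ h => stableRank_orbitAct_of_isExtension h _)
      (fun _ V _ => stableRank_orbitAct_twist V _ _) (stableRank_component_segmentModule k.2)
      fun l hl => stableRank_component_segmentModule_of_ne l.2 k.2 fun h => hl (Subtype.ext h.symm)

theorem finrank_piece {d : Fin p →₀ ℕ} (hd : d ≠ 0) :
    Module.finrank ℂ (piece p d) = 2 + d.support.card := by
  obtain ⟨k₀, hk₀⟩ := Finsupp.support_nonempty_iff.mpr hd
  rw [piece_eq_span_simpleClass, finrank_span_eq_card (linearIndependent_simpleClass
    ((evalOrbit_toM_eq_zero_iff (Multiplicative.ofAdd d) k₀).mpr hk₀)), Fintype.card_sum,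
    Fintype.card_bool, Fintype.card_of_subtype d.support fun k =>
      (evalOrbit_toM_eq_zero_iff (Multiplicative.ofAdd d) k).symm]

theorem range_simpleClass_one : Set.range (simpleClass (1 : M p)) =
    {classAp 1 (xModule ((1 : M p) : ℂ[T;T⁻¹]))} := by
  refine Set.eq_singleton_iff_unique_mem.mpr ⟨⟨.inl true, rfl⟩, ?_⟩
  rintro _ ⟨(_ | _) | ⟨k, hk⟩, rfl⟩
  · exact congrArg (classAp 1) yModule_one
  · rfl
  · rw [OneMemClass.coe_one, map_one] at hk
    exact absurd hk one_ne_zero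

theorem finrank_piece_zero : Module.finrank ℂ (piece p 0) = 1 := by
  rw [piece_eq_span_simpleClass, ofAdd_zero, map_one, range_simpleClass_one]
  refine finrank_span_singleton fun h => ?_
  have hone := eq_zero_of_additive (ι := Unit) (g := fun _ => 1)
    (V := fun _ => xModule ((1 : M p) : ℂ[T;T⁻¹])) (i := ())
    (by rw [Fintype.sum_unique, one_smul, h])
    (fun t V => stableRank (act V (GWA.X (σ p) (t : ℂ[T;T⁻¹]))))
    (fun _ _ _ _ h => stableRank_act_of_isExtension h _)
    (fun _ V _ => stableRank_act_X_twist V _) stableRank_act_X_xModule fun _ h => absurd rfl h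
  exact one_ne_zero hone

end Components

section Grading

variable (p) in
/-- The isomorphism of `ℕ^p` with `M`. -/
noncomputable def equivM : (Fin p →₀ ℕ) ≃ M p :=
  Multiplicative.ofAdd.trans (Equiv.ofBijective (toM p) ⟨toM_injective, toM_surjective⟩)

theorem classAp_mem_piece_symm (t : M p) (V : WeightModule (σ p) (ω p) (t : ℂ[T;T⁻¹])) :
    classAp t V ∈ piece p ((equivM p).symm t) :=
  classAp_mem_piece ((equivM p).apply_symm_apply t) V

variable (p) in
/-- The decomposition of `𝒜(p)` into its components. -/
noncomputable def decomposeAp : Ap p →ₗ[ℂ] DirectSum (Fin p →₀ ℕ) fun d => piece p d :=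
  liftAp (fun t V => DirectSum.lof ℂ _ (fun d => piece p d) ((equivM p).symm t)
      ⟨classAp t V, classAp_mem_piece_symm t V⟩)
    (fun t U V W h => by
      rw [← map_add]
      exact congrArg _ (Subtype.ext (classAp_eq_add h)))
    (fun t V ξ => congrArg _ (Subtype.ext (classAp_twist_pointUnit ξ)))

theorem decomposeAp_classAp {d : Fin p →₀ ℕ} {t : M p} (h : (equivM p).symm t = d)
    (V : WeightModule (σ p) (ω p) (t : ℂ[T;T⁻¹])) (hV : classAp t V ∈ piece p d) :
    decomposeAp p (classAp t V) = DirectSum.lof ℂ _ (fun d => piece p d) d ⟨classAp t V, hV⟩ := by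
  subst h
  exact liftAp_classAp _ _ _ t V

theorem coeLinearMap_comp_decomposeAp :
    DirectSum.coeLinearMap (piece p) ∘ₗ decomposeAp p = LinearMap.id := by
  have h : (DirectSum.coeLinearMap (piece p) ∘ₗ decomposeAp p) ∘ₗ (toAp p).toLinearMap =
      (toAp p).toLinearMap := by
    refine GrothendieckRing.hom_ext fun t V => ?_
    change DirectSum.coeLinearMap (piece p) (decomposeAp p (classAp t V)) = classAp t V
    rw [decomposeAp_classAp rfl V (classAp_mem_piece_symm t V), DirectSum.coeLinearMap_lof]
  refine LinearMap.ext fun x => ?_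
  obtain ⟨x, rfl⟩ := Ideal.Quotient.mkₐ_surjective ℂ (uIdeal p) x
  exact LinearMap.congr_fun h x

theorem decomposeAp_coe {d : Fin p →₀ ℕ} (x : piece p d) :
    decomposeAp p x = DirectSum.lof ℂ _ (fun d => piece p d) d x := by
  let S : Submodule ℂ (piece p d) := LinearMap.eqLocus (decomposeAp p ∘ₗ (piece p d).subtype)
    (DirectSum.lof ℂ _ (fun d => piece p d) d)
  have hS : piece p d ≤ S.map (piece p d).subtype := piece_le fun V =>
    ⟨⟨classAp _ V, classAp_mem_piece rfl V⟩,
      decomposeAp_classAp ((equivM p).symm_apply_apply d) V _, rfl⟩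
  obtain ⟨y, hy, hyx⟩ := hS x.2
  exact Subtype.ext hyx ▸ hy

theorem decomposeAp_comp_coeLinearMap :
    decomposeAp p ∘ₗ DirectSum.coeLinearMap (piece p) = LinearMap.id := by
  refine DirectSum.linearMap_ext ℂ fun d => LinearMap.ext fun x => ?_
  rw [LinearMap.comp_apply, LinearMap.comp_apply, DirectSum.coeLinearMap_lof, decomposeAp_coe,
    LinearMap.comp_apply, LinearMap.id_apply]

theorem piece_mul_piece_le (d e : Fin p →₀ ℕ) : piece p d * piece p e ≤ piece p (d + e) := by
  rw [piece_eq_span_classAp d, piece_eq_span_classAp e, Submodule.span_mul_span,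
    Submodule.span_le]
  rintro _ ⟨_, ⟨V, rfl⟩, _, ⟨W, rfl⟩, rfl⟩
  change classAp _ V * classAp _ W ∈ _
  rw [classAp, classAp, ← map_mul, GrothendieckRing.cls_mul_cls]
  exact classAp_mem_piece (map_mul (toM p) _ _) _

noncomputable instance gradedAlgebraPiece : GradedAlgebra (piece p) where
  one_mem := by
    rw [← toAp_u 1]
    exact classAp_mem_piece (map_one (toM p)) (uModule p 1)
  mul_mem := fun _ _ _ _ hx hy => piece_mul_piece_le _ _ (Submodule.mul_mem_mul hx hy)
  toDecomposition := DirectSum.Decomposition.ofLinearMap _ (decomposeAp p)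
    coeLinearMap_comp_decomposeAp decomposeAp_comp_coeLinearMap

end Grading

section DimensionSeries

theorem dimSeries_eq : dimSeries p =
    -1 + (2 + ∑ i, MvPowerSeries.X i) * (∏ i, (1 - MvPowerSeries.X i))⁻¹ := by
  classical
  ext d
  rw [map_add, map_neg, coeff_two_add_sum_X_mul_inv, MvPowerSeries.coeff_one]
  change (Module.finrank ℂ (piece p d) : ℚ) = _
  split_ifs with hd
  · rw [hd, finrank_piece_zero, Finsupp.support_zero, Finset.card_empty]
    norm_num
  · rw [finrank_piece hd, neg_zero, zero_add]
    norm_cast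

theorem totalPiece_eq_iSup (n : ℕ) : totalPiece p n =
    ⨆ d : Finset.finsuppAntidiag (Finset.univ : Finset (Fin p)) n, piece p d := by
  rw [totalPiece, iSup_subtype]
  simp only [Finset.mem_finsuppAntidiag, Finset.subset_univ, and_true]

instance finite_totalPiece (n : ℕ) : Module.Finite ℂ (totalPiece p n) := by
  rw [totalPiece_eq_iSup]
  infer_instance

theorem finrank_totalPiece (n : ℕ) : Module.finrank ℂ (totalPiece p n) =
    ∑ d ∈ Finset.finsuppAntidiag Finset.univ n, Module.finrank ℂ (piece p d) := by
  classical
  have hindep : iSupIndep fun d : Finset.finsuppAntidiag (Finset.univ : Finset (Fin p)) n =>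
      piece p d :=
    (DirectSum.Decomposition.isInternal (piece p)).submodule_iSupIndep.comp Subtype.val_injective
  rw [totalPiece_eq_iSup, finrank_iSup_of_iSupIndep hindep,
    Finset.sum_coe_sort _ fun d => Module.finrank ℂ (piece p d)]

theorem diagonalize_dimSeries : diagonalize (Fin p) ℚ (dimSeries p) = hilbertSeries p := by
  ext n
  rw [coeff_diagonalize, hilbertSeries, PowerSeries.coeff_mk, finrank_totalPiece, Nat.cast_sum]
  rfl

theorem hilbertSeries_eq : hilbertSeries p =
    -1 + (2 + (p : PowerSeries ℚ) * PowerSeries.X) * ((1 - PowerSeries.X) ^ p)⁻¹ := by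
  have hconst : MvPowerSeries.constantCoeff
      (∏ i, (1 - MvPowerSeries.X i) : MvPowerSeries (Fin p) ℚ) ≠ 0 := by simp
  rw [← diagonalize_dimSeries, dimSeries_eq, map_add, map_mul, diagonalize_inv hconst, map_neg,
    map_add, map_sum, map_prod]
  simp only [map_sub, map_one, map_ofNat, diagonalize_X, Finset.sum_const, Finset.prod_const,
    Finset.card_univ, Fintype.card_fin, nsmul_eq_mul]

end DimensionSeries

end RootOfUnityGWA

theorem proposition4p5 (p : ℕ) [NeZero p] :
    -- `M` is identified with `ℕ^p`, and the components form a grading of `𝒜(p)` by `ℕ^p`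
    Function.Bijective (RootOfUnityGWA.toM p) ∧
    Nonempty (GradedAlgebra (RootOfUnityGWA.piece p)) ∧
    -- the multigraded dimension series
    (∀ d, Module.Finite ℂ (RootOfUnityGWA.piece p d)) ∧
    RootOfUnityGWA.dimSeries p =
      -1 + (2 + ∑ i, MvPowerSeries.X i) * (∏ i, (1 - MvPowerSeries.X i))⁻¹ ∧
    -- the Hilbert series
    (∀ n, Module.Finite ℂ (RootOfUnityGWA.totalPiece p n)) ∧
    RootOfUnityGWA.hilbertSeries p =
      -1 + (2 + (p : PowerSeries ℚ) * PowerSeries.X) * ((1 - PowerSeries.X) ^ p)⁻¹ :=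
  ⟨⟨RootOfUnityGWA.toM_injective, RootOfUnityGWA.toM_surjective⟩,
    ⟨RootOfUnityGWA.gradedAlgebraPiece⟩, RootOfUnityGWA.finite_piece,
    RootOfUnityGWA.dimSeries_eq, RootOfUnityGWA.finite_totalPiece,
    RootOfUnityGWA.hilbertSeries_eq⟩
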